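/- Let $M,N\ge 0$ and let $q\in\mathbb C$ be nonzero and not a root of unity. For $1\le a\le M+N$ put $[a]=0$ if $a\le M$ and $[a]=1$ if $a>M$. Let $V$ be the superspace with basis $v^1,\dots,v^{M+N}$, $v^a$ of parity $[a]$, let $e^a_b\in \mathrm{End}(V)$ be the matrix units, $e^a_bv^c=\delta_b^c v^a$, and let $$R(x)=q^{\sum_a(-1)^{[a]}e^a_a\otimes e^a_a}-x^{-1}q^{-\sum_a(-1)^{[a]}e^a_a\otimes e^a_a}+(q-q^{-1})\Big(x^{-1}\sum_{a<b}+\sum_{a>b}\Big)(-1)^{[b]}e^a_b\otimes e^b_a$$ be the Perk--Schultz $R$-matrix. All tensor products are $\mathbb Z_2$-graded. Consider the $\mathbb Z_2$-graded unital associative $\mathbb C$-algebra $Y_q(\mathfrak{gl}(M|N))$ generated by elements $T^a_b[k]$ of parity $[a]+[b]$, with the relations $$R_{12}(x)L_1(xy)L_2(y)=L_2(y)L_1(xy)R_{12}(x),\qquad L(x)=\sum_{a,b}(-1)^{[b]}e^a_b\otimes T^b_a(x),\quad T^b_a(x)=\sum_{k\ge 0}x^{-k}T^b_a[k],$$ read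 coefficientwise in $x^{-1},y^{-1}$, in either of the following two versions: (i) the generators are the $T^a_b[k]$ with $k>0$, and $T^a_b[0]=(-1)^{[a]}\delta^a_b$, so that $L(x)=1+O(x^{-1})$; (ii) the generators are the $T^a_b[k]$ with $k\ge 0$ together with the entries of a two-sided inverse of the constant term $L[0]$ of $L(x)$. Let $\pi(q^{h_{2\rho}})=\sum_a q^{d_a}e^a_a$ with $d_a=M-N+1-2a$ for $a\le M$ and $d_a=2a-3M-N-1$ for $a>M$; thus $\sum_a(-1)^{[a]}d_a=0$, and $d_a-d_{a+1}=2(-1)^{[a]}$ for $a\neq M$, while $d_M=d_{M+1}$ if $M,N\geq 1$. Then, in both versions, $L(x)$ has a unique two-sided inverse $L^{-1}(x)$ with coefficients in $Y_q(\mathfrak{gl}(M|N))$, and every coefficient $C_n$ of $$C(x)=\mathrm{str}_\pi\big[\pi(q^{h_{2\rho}})\,L^{-1}(xq^{2(M-N)})\,L(x)\big]=\sum_{n\ge 0}x^{-n}C_n$$ lies in the center of $Y_q(\mathfrak{gl}(M|N))$; that is, $[C_n,T^a_b[k]]=0$ for all $a,b,k,n$. -/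

import Mathlib

noncomputable section

namespace SuperYangian

/-! Throughout, indices `a : Fin (M + N)` are counted from `0`; the first `M` are even and the
last `N` are odd. Generating series in `x⁻¹` are elements of `PowerSeries A`, whose variable
stands for `x⁻¹`. -/

/-- The parity `[a]` of the index `a`. -/
def par {M N : ℕ} (a : Fin (M + N)) : ℕ := if (a : ℕ) < M then 0 else 1

section Operators

variable {M N : ℕ} {A : Type} [Ring A]

/-- The even element `∑ e^a_b ⊗ X a b` of `End V ⊗ A`, given by its coefficients. For all elements
used below, `X a b` has parity `[a] + [b]`. -/
abbrev Op1 (M N : ℕ) (A : Type) : Type := Fin (M + N) → Fin (M + N) → A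

/-- The even element `∑ e^a_b ⊗ e^c_d ⊗ X a b c d` of `End V ⊗ End V ⊗ A`, given by its
coefficients. For all elements used below, `X a b c d` has parity `[a] + [b] + [c] + [d]`. -/
abbrev Op2 (M N : ℕ) (A : Type) : Type :=
  Fin (M + N) → Fin (M + N) → Fin (M + N) → Fin (M + N) → A

/-- The unit `∑ e^a_a ⊗ 1` of `End V ⊗ A`. -/
def one1 : Op1 M N A := fun a b => if a = b then 1 else 0

/-- Multiplication of even elements in the graded tensor product `End V ⊗ A`:
`(e^a_p ⊗ x) (e^p_b ⊗ y) = (-1)^([x] ([p] + [b])) e^a_b ⊗ x y` with `[x] = [a] + [p]`. -/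
def mul1 (X Y : Op1 M N A) : Op1 M N A := fun a b =>
  ∑ p, (-1) ^ ((par a + par p) * (par p + par b)) * (X a p * Y p b)

/-- Multiplication of even elements in the graded tensor product `End V ⊗ End V ⊗ A`:
`(e^a_p ⊗ e^c_r ⊗ x) (e^p_b ⊗ e^r_d ⊗ y)` equals `e^a_b ⊗ e^c_d ⊗ x y` up to the sign that comes
from moving `e^p_b` to the left past `e^c_r ⊗ x`, and `e^r_d` to the left past `x`, where
`[x] = [a] + [p] + [c] + [r]`. -/
def mul2 (X Y : Op2 M N A) : Op2 M N A := fun a b c d =>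
  ∑ p, ∑ r,
    (-1) ^ ((par p + par b) * ((par c + par r) + (par a + par p + par c + par r))
        + (par r + par d) * (par a + par p + par c + par r))
      * (X a p c r * Y p b r d)

/-- `X₁`: the element `X` of `End V ⊗ A` placed in the first and third factors of
`End V ⊗ End V ⊗ A`. -/
def leg1 (X : Op1 M N A) : Op2 M N A := fun a b c d => if c = d then X a b else 0

/-- `X₂`: the element `X` of `End V ⊗ A` placed in the second and third factors of
`End V ⊗ End V ⊗ A`. -/
def leg2 (X : Op1 M N A) : Op2 M N A := fun a b c d => if a = b then X c d else 0

/-- `Y` is a two-sided inverse of `X` in `End V ⊗ A`. -/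
def IsInv1 (X Y : Op1 M N A) : Prop := mul1 X Y = one1 ∧ mul1 Y X = one1

end Operators

section RMatrix

/-- The coefficients of the Perk--Schultz `R`-matrix `R(x) = R[0] + R[1] x⁻¹`:
`R[0] = q^(∑ (-1)^[a] e^a_a ⊗ e^a_a) + (q - q⁻¹) ∑_{a > b} (-1)^[b] e^a_b ⊗ e^b_a`,
`R[1] = -q^(-∑ (-1)^[a] e^a_a ⊗ e^a_a) + (q - q⁻¹) ∑_{a < b} (-1)^[b] e^a_b ⊗ e^b_a`,
and `R[m] = 0` for `m ≥ 2`. -/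
def Rcoef (M N : ℕ) (q : ℂ) : ℕ → Op2 M N ℂ
  | 0 => fun a b c d =>
      (if a = b ∧ c = d then (if a = c then q ^ ((-1 : ℤ) ^ par a) else 1) else 0)
        + (if a = d ∧ b = c ∧ b < a then (q - q⁻¹) * (-1) ^ par b else 0)
  | 1 => fun a b c d =>
      (if a = b ∧ c = d then -(if a = c then q ^ (-((-1 : ℤ) ^ par a)) else 1) else 0)
        + (if a = d ∧ b = c ∧ a < b then (q - q⁻¹) * (-1) ^ par b else 0)
  | _ => 0

variable {M N : ℕ} {A : Type} [Ring A] [Algebra ℂ A]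

/-- The coefficient `R[m]`, regarded as the element `R[m] ⊗ 1` of `End V ⊗ End V ⊗ A`. -/
def RcoefA (q : ℂ) (m : ℕ) : Op2 M N A := fun a b c d => algebraMap ℂ A (Rcoef M N q m a b c d)

/-- The coefficient `L[k]` of `x⁻ᵏ` in `L(x) = ∑ (-1)^[b] e^a_b ⊗ T^b_a(x)`, where
`T a b k` stands for `T^a_b[k]` (upper index first). -/
def Lcoef (T : Fin (M + N) → Fin (M + N) → ℕ → A) (k : ℕ) : Op1 M N A :=
  fun a b => (-1) ^ par b * T b a k

/-- The coefficient of `x⁻ⁱ y⁻ʲ` in `R₁₂(x) L₁(x y) L₂(y)`. -/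
def rllLeft (q : ℂ) (T : Fin (M + N) → Fin (M + N) → ℕ → A) (i j : ℕ) : Op2 M N A :=
  ∑ m ∈ Finset.range 2, ∑ kl ∈ Finset.HasAntidiagonal.antidiagonal j,
    if m + kl.1 = i then
      mul2 (mul2 (RcoefA q m) (leg1 (Lcoef T kl.1))) (leg2 (Lcoef T kl.2))
    else 0

/-- The coefficient of `x⁻ⁱ y⁻ʲ` in `L₂(y) L₁(x y) R₁₂(x)`. -/
def rllRight (q : ℂ) (T : Fin (M + N) → Fin (M + N) → ℕ → A) (i j : ℕ) : Op2 M N A :=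
  ∑ m ∈ Finset.range 2, ∑ kl ∈ Finset.HasAntidiagonal.antidiagonal j,
    if m + kl.1 = i then
      mul2 (mul2 (leg2 (Lcoef T kl.2)) (leg1 (Lcoef T kl.1))) (RcoefA q m)
    else 0

end RMatrix

section Yangian

variable (M N : ℕ) (q : ℂ)

/-- The symbols `T^a_b[k]`, `k ≥ 0`, in the free algebra on the `T^a_b[k]` with `k > 0`, where
`T^a_b[0]` is the scalar `(-1)^[a] δ^a_b`. -/
def freeT (a b : Fin (M + N)) (k : ℕ) : FreeAlgebra ℂ (Fin (M + N) × Fin (M + N) × ℕ+) :=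
  if h : 0 < k then FreeAlgebra.ι ℂ (a, b, ⟨k, h⟩) else if a = b then (-1) ^ par a else 0

/-- The defining relations `R₁₂(x) L₁(x y) L₂(y) = L₂(y) L₁(x y) R₁₂(x)`, coefficientwise, for the
normalization `L(x) = 1 + O(x⁻¹)`. -/
inductive UnitalRel : FreeAlgebra ℂ (Fin (M + N) × Fin (M + N) × ℕ+) →
    FreeAlgebra ℂ (Fin (M + N) × Fin (M + N) × ℕ+) → Prop
  | rll (i j : ℕ) (a b c d : Fin (M + N)) :
      UnitalRel (rllLeft q (freeT M N) i j a b c d) (rllRight q (freeT M N) i j a b c d)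

/-- The quantum super Yangian with generators `T^a_b[k]`, `k > 0`, and
`T^a_b(x) = (-1)^[a] δ^a_b + ∑_{k > 0} x⁻ᵏ T^a_b[k]`. -/
abbrev UnitalYangian : Type := RingQuot (UnitalRel M N q)

/-- The elements `T^a_b[k]` of `UnitalYangian`. -/
def unitalT (a b : Fin (M + N)) (k : ℕ) : UnitalYangian M N q :=
  RingQuot.mkAlgHom ℂ (UnitalRel M N q) (freeT M N a b k)

/-- Generators of the quantum super Yangian with free constant term: the symbols `T^a_b[k]`,
`k ≥ 0`, and the coefficients of `e^a_b` in the inverse of `L[0]`. -/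
inductive Gen : Type
  | T (a b : Fin (M + N)) (k : ℕ) : Gen
  | invL0 (a b : Fin (M + N)) : Gen

/-- `T^a_b[k]`, `k ≥ 0`, in the free algebra on `Gen`. -/
def genT (a b : Fin (M + N)) (k : ℕ) : FreeAlgebra ℂ (Gen M N) := FreeAlgebra.ι ℂ (Gen.T a b k)

/-- The formal inverse of `L[0]` with coefficients in the free algebra on `Gen`. -/
def genInv : Op1 M N (FreeAlgebra ℂ (Gen M N)) := fun a b => FreeAlgebra.ι ℂ (Gen.invL0 a b)

/-- The relations `R₁₂(x) L₁(x y) L₂(y) = L₂(y) L₁(x y) R₁₂(x)`, coefficientwise, and those that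
make `L[0]` invertible. -/
inductive YangianRel : FreeAlgebra ℂ (Gen M N) → FreeAlgebra ℂ (Gen M N) → Prop
  | rll (i j : ℕ) (a b c d : Fin (M + N)) :
      YangianRel (rllLeft q (genT M N) i j a b c d) (rllRight q (genT M N) i j a b c d)
  | mul_inv (a b : Fin (M + N)) :
      YangianRel (mul1 (Lcoef (genT M N) 0) (genInv M N) a b) (one1 a b)
  | inv_mul (a b : Fin (M + N)) :
      YangianRel (mul1 (genInv M N) (Lcoef (genT M N) 0) a b) (one1 a b)

/-- The quantum super Yangian with `T^a_b(x) = ∑_{k ≥ 0} x⁻ᵏ T^a_b[k]`, where `L[0]` is only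
required to be invertible. -/
abbrev Yangian : Type := RingQuot (YangianRel M N q)

/-- The elements `T^a_b[k]` of `Yangian`. -/
def yangianT (a b : Fin (M + N)) (k : ℕ) : Yangian M N q :=
  RingQuot.mkAlgHom ℂ (YangianRel M N q) (genT M N a b k)

end Yangian

section Casimir

/-- The eigenvalue of `π(h_{2ρ})` on the basis vector of index `a`. -/
def twoRho {M N : ℕ} (a : Fin (M + N)) : ℤ :=
  if (a : ℕ) < M then (M : ℤ) - N - 1 - 2 * (a : ℕ) else 2 * (a : ℕ) - 3 * (M : ℤ) - N + 1

/-- `[π(h_{2ρ}), e^a_{a+1}] = 2 (-1)^[a] e^a_{a+1}`, except that the commutator is `0` if `a` is the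
last even index. -/
theorem twoRho_sub {M N : ℕ} (a b : Fin (M + N)) (h : (b : ℕ) = a + 1) :
    (twoRho a - twoRho b : ℤ) = if (b : ℕ) = M then 0 else 2 * (-1) ^ par a := by
  unfold twoRho par
  split_ifs <;> omega

/-- `str π(h_{2ρ}) = 0`, that is, `π(h_{2ρ})` is a linear combination of the
`π(h_a) = (-1)^[a] e^a_a - (-1)^[a+1] e^{a+1}_{a+1}`. -/
theorem sum_twoRho (M N : ℕ) : ∑ a : Fin (M + N), (-1) ^ par a * twoRho a = 0 := by
  have h1 : ∀ (c : ℤ) (n : ℕ), ∑ i : Fin n, (c - 2 * ((i : ℕ) : ℤ)) = n * c - n * (n - 1) := by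
    intro c n
    induction n with
    | zero => simp
    | succ k ih => rw [Fin.sum_univ_castSucc]; simp only [Fin.val_castSucc, Fin.val_last, ih]
                   push_cast; ring
  rw [Fin.sum_univ_add]
  have e1 : ∀ i : Fin M, (-1 : ℤ) ^ par (Fin.castAdd N i) * twoRho (Fin.castAdd N i)
      = ((M : ℤ) - N - 1) - 2 * ((i : ℕ) : ℤ) := by
    intro i; simp [par, twoRho]
  have e2 : ∀ i : Fin N, (-1 : ℤ) ^ par (Fin.natAdd M i) * twoRho (Fin.natAdd M i)
      = ((M : ℤ) + N - 1) - 2 * ((i : ℕ) : ℤ) := by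
    intro i; simp [par, twoRho]; ring
  rw [Finset.sum_congr rfl (fun i _ => e1 i), Finset.sum_congr rfl (fun i _ => e2 i), h1, h1]
  ring

variable {M N : ℕ} {A : Type} [Ring A] [Algebra ℂ A]

/-- The series `L(x) = ∑ₖ L[k] x⁻ᵏ` in `End V ⊗ A[[x⁻¹]]`. -/
def Lser (T : Fin (M + N) → Fin (M + N) → ℕ → A) : Op1 M N (PowerSeries A) :=
  fun a b => PowerSeries.mk fun k => Lcoef T k a b

/-- For `X = X(x)` in `End V ⊗ A[[x⁻¹]]`, the element `X(x s)`: the coefficient of `x⁻ᵏ` is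
multiplied by `s⁻ᵏ`. -/
def shift (s : ℂ) (X : Op1 M N (PowerSeries A)) : Op1 M N (PowerSeries A) :=
  fun a b => PowerSeries.mk fun k => (s⁻¹) ^ k • PowerSeries.coeff k (X a b)

/-- `str_π[π(q^{h_{2ρ}}) X]` for `X` in `End V ⊗ A[[x⁻¹]]`. -/
def qstr (q : ℂ) (X : Op1 M N (PowerSeries A)) : PowerSeries A :=
  ∑ a, ((-1 : ℂ) ^ par a * q ^ twoRho a) • X a a

/-- `C(x) = str_π[π(q^{h_{2ρ}}) L⁻¹(x q^{2(M-N)}) L(x)]`, as a power series in `x⁻¹`, where `Linv`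
is the inverse of `L`. -/
def casimir (q : ℂ) (L Linv : Op1 M N (PowerSeries A)) : PowerSeries A :=
  qstr q (mul1 (shift (q ^ (2 * ((M : ℤ) - N))) Linv) L)

end Casimir

end SuperYangian

end

open SuperYangian

noncomputable section

namespace SuperYangian

/-! ### Scalar identities for `R`: unitarity, crossing, and the degeneration at `q^(2(M-N))`. -/

section Scalars

variable {M N : ℕ}

/-! Write s = q^(2(M-N)) and θ_a for `strWeight q a`. Two scalar facts about `R` carry the argument:
unitarity, R₂₁(x⁻¹) R₁₂(x) = scalar (`sum_Rflip_mul_Rmat`), and crossing, which says that the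
θ-weighted partial transposes in the first factor of R₂₁((xs)⁻¹) and R₁₂(x) are inverse to each
other up to a scalar (`sum_Rflip_crossing`, `sum_crossing_Rflip`). Both scalars are nonzero for all
but finitely many x.

The defining relation gives L₁⁻¹(xy) R₂₁(x⁻¹) L₂(y) = L₂(y) R₂₁(x⁻¹) L₁⁻¹(xy) (`rll_inv_blocks`). At
x = s the partial transpose of R₂₁(s⁻¹) kills a vector built from θ, so a weighted sum of entries of
the right side vanishes. If s ≠ 1, the resulting linear relations force the partial transposes of
L⁻¹(sy) and L(y) to be inverse up to one series Z(y) (`exists_transpose_inverse`), and C(y) = (∑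
θ_d) Z(y). If M = N, then s = 1 and C is a scalar because L⁻¹L = 1.

For generic x, pulling L₂(y) through the weighted supertrace of L₁⁻¹(xsy) L₁(xy) by unitarity and
crossing shows that Z(xy) commutes with L(y) (`block_commute`). Each coefficient in y of this
identity is polynomial in x⁻¹, so infinitely many x suffice to make all coefficients of Z commute
with all those of L (`commute_coeff_of_rescale`).

Gradings are eliminated at the outset: `tw1` and `tw2` turn even elements of the graded tensor
products into ordinary matrices, and the only signs left are those in `blk` and in `Rmat`. -/

theorem par_eq_zero_or_one (a : Fin (M + N)) : par a = 0 ∨ par a = 1 := by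
  unfold par; split_ifs <;> simp

/-- The coefficient of `e^a_a ⊗ e^c_c` in the Perk--Schultz matrix. -/
def diagWeight (q x : ℂ) (a c : Fin (M + N)) : ℂ :=
  if a = c then q ^ ((-1 : ℤ) ^ par a) - x⁻¹ * q ^ (-((-1 : ℤ) ^ par a)) else 1 - x⁻¹

/-- The coefficient of `e^a_b ⊗ e^b_a`, `a ≠ b`, in the Perk--Schultz matrix acting on `V ⊗ V`. -/
def flipWeight (q x : ℂ) (a b : Fin (M + N)) : ℂ :=
  if a = b then 0 else
    (q - q⁻¹) * (-1) ^ (par a * par b) * (if a < b then x⁻¹ else 1)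

/-- Matrix entries of `R(x)` acting on `V ⊗ V`. -/
def Rmat (q x : ℂ) (a b c d : Fin (M + N)) : ℂ :=
  (if a = b then if c = d then diagWeight q x a c else 0 else 0)
    + (if a = d then if c = b then flipWeight q x a b else 0 else 0)

/-- Matrix entries of `R₂₁(x⁻¹)` acting on `V ⊗ V`. -/
def Rflip (q x : ℂ) (a b c d : Fin (M + N)) : ℂ := Rmat q x⁻¹ c d a b

/-- The factor in `R₂₁(x⁻¹) R₁₂(x) = unitarity q x`. -/
def unitarity (q x : ℂ) : ℂ := (q - x⁻¹ * q⁻¹) * (q - x * q⁻¹)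

/-- The weights of the quantum supertrace. -/
def strWeight (q : ℂ) (a : Fin (M + N)) : ℂ := (-1) ^ par a * q ^ twoRho a

/-- Powers of `q` whose differences are the weights of the quantum supertrace. -/
def qPartial (M N : ℕ) (q : ℂ) (k : ℕ) : ℂ :=
  q ^ (if k ≤ M then (M : ℤ) - N - 2 * k else 2 * k - 3 * M - N)

variable {q : ℂ}

theorem qPartial_val (hq : q ≠ 0) (a : Fin (M + N)) :
    qPartial M N q a = q ^ twoRho a * q ^ ((-1 : ℤ) ^ par a) := by
  rw [← zpow_add₀ hq]
  unfold qPartial twoRho par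
  congr 1
  split_ifs <;> omega

theorem qPartial_val_succ (hq : q ≠ 0) (a : Fin (M + N)) :
    qPartial M N q (a + 1) = q ^ twoRho a * q ^ (-(-1 : ℤ) ^ par a) := by
  rw [← zpow_add₀ hq]
  unfold qPartial twoRho par
  congr 1
  split_ifs <;> omega

/-- This is the origin of the shift 2(M-N): the two ends of the telescoping sums below cancel
exactly for this power of `q`. -/
theorem qPartial_zero_eq (hq : q ≠ 0) :
    qPartial M N q 0 = q ^ (2 * ((M : ℤ) - N)) * qPartial M N q (M + N) := by
  unfold qPartial
  rw [← zpow_add₀ hq]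
  congr 1
  split_ifs <;> push_cast <;> omega

theorem strWeight_ne_zero (hq : q ≠ 0) (a : Fin (M + N)) : strWeight q a ≠ 0 := by
  unfold strWeight
  exact mul_ne_zero (pow_ne_zero _ (by norm_num)) (zpow_ne_zero _ hq)

theorem mul_strWeight (hq : q ≠ 0) (a : Fin (M + N)) :
    (q - q⁻¹) * strWeight q a = qPartial M N q a - qPartial M N q (a + 1) := by
  rw [qPartial_val hq, qPartial_val_succ hq]
  unfold strWeight
  rcases par_eq_zero_or_one a with h | h <;> simp [h] <;> ring

/-- The step function equal to `1` up to `p` and to `z` beyond. -/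
def step (z : ℂ) (p k : ℕ) : ℂ := if k ≤ p then 1 else z

/-- Off the diagonal the weight of the flip depends only on the order of `a` and `p`, so with
`mul_strWeight` each term is a difference; the diagonal term supplies exactly the jump of `step`
from 1 to `z`. -/
theorem strWeight_mul_flip (hq : q ≠ 0) (z : ℂ) (p a : Fin (M + N)) :
    strWeight q a * ((-1) ^ (par a * par p) *
      ((if a = p then diagWeight q z⁻¹ p a else 0) + flipWeight q z⁻¹ p a))
    = step z p a * qPartial M N q a - step z p (a + 1) * qPartial M N q (a + 1) := by
  rcases lt_trichotomy a p with h | h | h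
  · have h1 : (a : ℕ) < p := h
    have e1 : step z p a = 1 := by simp [step, h1.le]
    have e2 : step z p (a + 1) = 1 := by simp [step, h1]
    rw [e1, e2, one_mul, one_mul, ← mul_strWeight hq]
    simp only [h.ne, h.ne', not_lt_of_gt h, flipWeight, if_false, zero_add]
    rcases par_eq_zero_or_one a with h | h <;> rcases par_eq_zero_or_one p with h' | h' <;>
      simp [h, h'] <;> ring
  · subst h
    have e1 : step z a a = 1 := by simp [step]
    have e2 : step z a (a + 1) = z := by simp [step]
    rw [e1, e2, qPartial_val hq, qPartial_val_succ hq]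
    unfold strWeight flipWeight diagWeight
    rcases par_eq_zero_or_one a with h | h <;> simp [h] <;> ring
  · have h1 : (p : ℕ) < a := h
    have e1 : step z p a = z := if_neg (by omega)
    have e2 : step z p (a + 1) = z := if_neg (by omega)
    rw [e1, e2, ← mul_sub, ← mul_strWeight hq]
    simp only [h.ne, h.ne', h, flipWeight, if_false, if_true, zero_add]
    rcases par_eq_zero_or_one a with h | h <;> rcases par_eq_zero_or_one p with h' | h' <;>
      simp [h, h'] <;> ring

theorem sum_telescope (n : ℕ) (f : ℕ → ℂ) :
    ∑ a : Fin n, (f a - f (a + 1)) = f 0 - f n := by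
  rw [Fin.sum_univ_eq_sum_range (fun k => f k - f (k + 1)) n, Finset.sum_range_sub']

/-- At `x = q^(2(M-N))` the partial transpose of `R₂₁(x⁻¹)` has a kernel. -/
theorem sum_strWeight_mul_flip (hq : q ≠ 0) (p : Fin (M + N)) :
    ∑ a, strWeight q a * ((-1) ^ (par a * par p) *
      ((if a = p then diagWeight q (q ^ (2 * ((M : ℤ) - N)))⁻¹ p a else 0)
        + flipWeight q (q ^ (2 * ((M : ℤ) - N)))⁻¹ p a)) = 0 := by
  simp only [strWeight_mul_flip hq]
  rw [sum_telescope (M + N) (fun k => step (q ^ (2 * ((M : ℤ) - N))) p k * qPartial M N q k)]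
  have e : step (q ^ (2 * ((M : ℤ) - N))) p (M + N) = q ^ (2 * ((M : ℤ) - N)) := by
    simp [step, p.2]
  simp only [e, ← qPartial_zero_eq hq]
  simp [step]

/-- The factor in the crossing relation. -/
def crossing (x s : ℂ) : ℂ := (1 - x * s) * (1 - x⁻¹)

/-- The part of crossing in which the flip terms of `R` interact. The summands telescope, apart from
one defect at `a = p = f` that produces the right-hand side. -/
theorem sum_crossing (hq : q ≠ 0) {x : ℂ} (hx : x ≠ 0) (p f : Fin (M + N)) :
    ∑ a, strWeight q a * ((-1) ^ (par a * par p) *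
      ((if a = p then diagWeight q (x * q ^ (2 * ((M : ℤ) - N)))⁻¹ p a else 0)
        + flipWeight q (x * q ^ (2 * ((M : ℤ) - N)))⁻¹ p a)) *
      ((-1) ^ (par a * par f) *
      ((if f = a then diagWeight q x f a else 0) + flipWeight q x f a))
    = if f = p then crossing x (q ^ (2 * ((M : ℤ) - N))) * strWeight q p else 0 := by
  set s := q ^ (2 * ((M : ℤ) - N)) with hs
  have hs0 : s ≠ 0 := zpow_ne_zero _ hq
  -- The primitive of the summand. Each of the two matrices contributes a step, `x * s` beyond `p`
  -- and `x⁻¹` beyond `f`; for `f = p` the steps merge into one with value `s`. In both cases the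
  -- value past the last index is `s`, so the ends cancel by `qPartial_zero_eq`.
  let F : ℕ → ℂ := fun k => (q - q⁻¹) *
    (step (if f = p then s else x * s) p k * (if f = p then 1 else step x⁻¹ f k)
      * qPartial M N q k)
  have key : ∀ a : Fin (M + N), strWeight q a * ((-1) ^ (par a * par p) *
      ((if a = p then diagWeight q (x * s)⁻¹ p a else 0)
        + flipWeight q (x * s)⁻¹ p a)) *
      ((-1) ^ (par a * par f) *
      ((if f = a then diagWeight q x f a else 0) + flipWeight q x f a))
      = (F a - F (a + 1))
        + if a = p then (if f = p then crossing x s * strWeight q p else 0) else 0 := by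
    intro a
    rw [strWeight_mul_flip hq]
    have hn : f ≠ a → ((-1) ^ (par a * par f) *
      ((if f = a then diagWeight q x f a else 0) + flipWeight q x f a))
        = (q - q⁻¹) * (if f < a then x⁻¹ else 1) := by
      intro h
      simp only [flipWeight, h, if_false, zero_add]
      rcases par_eq_zero_or_one a with h | h <;> rcases par_eq_zero_or_one f with h' | h' <;>
        simp only [h, h'] <;> ring
    have hn' : f = a → ((-1) ^ (par a * par f) *
      ((if f = a then diagWeight q x f a else 0) + flipWeight q x f a))
        = (-1) ^ par a * (q ^ ((-1 : ℤ) ^ par a) - x⁻¹ * q ^ (-((-1 : ℤ) ^ par a))) := by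
      rintro rfl
      simp only [flipWeight, diagWeight, if_true, add_zero]
      rcases par_eq_zero_or_one f with h | h <;> simp [h]
    by_cases hfp : f = p
    · subst hfp
      by_cases hfa : f = a
      · subst hfa
        rw [hn' rfl, qPartial_val hq, qPartial_val_succ hq]
        simp only [F, step, if_true, le_refl, Nat.not_succ_le_self, if_false, crossing,
          qPartial_val hq, qPartial_val_succ hq, strWeight]
        rcases par_eq_zero_or_one f with h | h <;> simp [h] <;> field_simp <;> ring
      · rw [hn hfa]
        simp only [F, step, if_true, if_neg (Ne.symm hfa), add_zero]
        rcases lt_or_gt_of_ne hfa with h | h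
        · have h1 : ¬ (a : ℕ) ≤ f := not_le.mpr h
          have h2 : ¬ (a : ℕ) + 1 ≤ f := by omega
          simp only [h1, h2, h, if_false, if_true]
          field_simp
        · have h0 : (a : ℕ) < f := h
          have h1 : (a : ℕ) ≤ f := h0.le
          have h2 : (a : ℕ) + 1 ≤ f := h0
          simp only [h1, h2, not_lt_of_gt h, if_false, if_true]
          ring
    · simp only [F, if_neg hfp, ite_self, add_zero]
      by_cases hfa : f = a
      · subst hfa
        rw [hn' rfl, qPartial_val hq, qPartial_val_succ hq]
        rcases lt_or_gt_of_ne hfp with h | h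
        · have h0 : (f : ℕ) < p := h
          have h1 : (f : ℕ) ≤ p := h0.le
          have h2 : (f : ℕ) + 1 ≤ p := h0
          simp only [step, h1, h2, if_true, le_refl, Nat.not_succ_le_self, if_false]
          rcases par_eq_zero_or_one f with h | h <;> simp [h] <;> field_simp <;> ring
        · have h0 : (p : ℕ) < f := h
          have h1 : ¬ (f : ℕ) ≤ p := by omega
          have h2 : ¬ (f : ℕ) + 1 ≤ p := by omega
          simp only [step, h1, h2, if_true, le_refl, Nat.not_succ_le_self, if_false]
          rcases par_eq_zero_or_one f with h | h <;> simp [h] <;> field_simp <;> ring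
      · rw [hn hfa]
        rcases lt_or_gt_of_ne hfa with h | h
        · have h1 : ¬ (a : ℕ) ≤ f := not_le.mpr h
          have h2 : ¬ (a : ℕ) + 1 ≤ f := by omega
          have e1 : step x⁻¹ f a = x⁻¹ := by simp [step, h1]
          have e2 : step x⁻¹ f (a + 1) = x⁻¹ := by simp only [step, h2, if_false]
          rw [e1, e2, if_pos h]; ring
        · have h0 : (a : ℕ) < f := h
          have h1 : (a : ℕ) ≤ f := h0.le
          have h2 : (a : ℕ) + 1 ≤ f := h0
          have e1 : step x⁻¹ f a = 1 := by simp [step, h1]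
          have e2 : step x⁻¹ f (a + 1) = 1 := by simp only [step, h2, if_true]
          rw [e1, e2, if_neg (not_lt_of_gt h)]; ring
  simp only [key]
  rw [Finset.sum_add_distrib, sum_telescope (M + N) F, Finset.sum_ite_eq' Finset.univ p]
  have hF : F 0 = F (M + N) := by
    have hp : ¬ M + N ≤ (p : ℕ) := by have := p.2; omega
    have hf : ¬ M + N ≤ (f : ℕ) := by have := f.2; omega
    simp only [F, step, hp, hf, if_false, Nat.zero_le, if_true, qPartial_zero_eq hq]
    split_ifs <;> field_simp <;> simp only [hs] <;> ring
  simp [hF]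

/-- Unitarity. `R` preserves each line spanned by v^a ⊗ v^a and each plane spanned by v^a ⊗ v^c and
v^c ⊗ v^a, so the check is one of 1×1 and 2×2 matrices. -/
theorem sum_Rflip_mul_Rmat (hq : q ≠ 0) {x : ℂ} (hx : x ≠ 0) (a b c d : Fin (M + N)) :
    ∑ p, ∑ t, Rflip q x a p c t * Rmat q x p b t d
      = if a = b ∧ c = d then unitarity q x else 0 := by
  have e : ∀ p t, Rflip q x a p c t * Rmat q x p b t d
      = (if c = t then if a = p then diagWeight q x⁻¹ c a * Rmat q x a b c d else 0 else 0)
        + (if c = p then if a = t then flipWeight q x⁻¹ c a * Rmat q x c b a d else 0 else 0) := by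
    intro p t
    unfold Rflip
    rw [Rmat]
    split_ifs <;> simp_all [add_mul]
  simp only [e, Finset.sum_add_distrib]
  simp only [Finset.sum_ite_eq, Finset.mem_univ, if_true, Finset.sum_ite_irrel,
    Finset.sum_const_zero]
  by_cases hac : a = c
  · subst hac
    have h0 : flipWeight q x⁻¹ a a = 0 := by simp [flipWeight]
    by_cases hb : a = b
    · subst hb
      by_cases hd : a = d
      · subst hd
        simp only [Rmat, if_true, diagWeight, flipWeight, unitarity, and_self]
        rcases par_eq_zero_or_one a with h | h <;> simp [h] <;> field_simp <;> ring
      · simp [Rmat, hd, h0]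
    · simp [Rmat, hb, h0]
  · have hca : c ≠ a := fun h => hac h.symm
    by_cases hb : a = b
    · subst hb
      by_cases hd : c = d
      · subst hd
        rcases lt_or_gt_of_ne hac with h | h <;>
        · simp only [Rmat, hac, hca, if_true, diagWeight, flipWeight, unitarity, and_self, if_false,
            h, not_lt_of_gt h]
          rcases par_eq_zero_or_one a with h | h <;> rcases par_eq_zero_or_one c with h' | h' <;>
          simp [h, h'] <;> field_simp <;> ring
      · simp [Rmat, hd, hca]
    · by_cases hcb : c = b
      · subst hcb
        by_cases hd : a = d
        · subst hd
          rcases lt_or_gt_of_ne hac with h | h <;>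
          · simp only [Rmat, hac, hca, if_true, diagWeight, flipWeight, and_self, if_false,
              h, not_lt_of_gt h]
            rcases par_eq_zero_or_one a with h | h <;> rcases par_eq_zero_or_one c with h' | h' <;>
            simp [h, h'] <;> field_simp <;> ring
        · simp [Rmat, hd, hac]
      · simp [Rmat, hb, hcb]

theorem Rflip_mul_Rmat_diag (x y : ℂ) (p f i l a j : Fin (M + N)) :
    Rflip q y a p i j * Rmat q x f a j l
      = (if i = j then if a = p then diagWeight q y⁻¹ i a * Rmat q x f a i l else 0 else 0)
        + (if a = j then if i = p then flipWeight q y⁻¹ i a * Rmat q x f a a l else 0 else 0) := by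
  unfold Rflip
  rw [Rmat]
  split_ifs <;> simp_all [add_mul]

theorem Rmat_inner (x : ℂ) (f a l : Fin (M + N)) :
    Rmat q x f a a l
      = if f = l then (if f = a then diagWeight q x f a else 0) + flipWeight q x f a else 0 := by
  unfold Rmat; split_ifs <;> simp_all [flipWeight]

theorem Rmat_of_ne (x : ℂ) {f a i l : Fin (M + N)} (h : i ≠ a) :
    Rmat q x f a i l = if f = a ∧ i = l then 1 - x⁻¹ else 0 := by
  unfold Rmat diagWeight
  by_cases hf : f = a
  · subst hf; simp [h, h.symm]
  · simp [h, hf]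

/-- Crossing. For `i ≠ p` only diagonal entries survive and give the product `crossing` directly;
for `i = p` the sum reduces to `sum_crossing`. -/
theorem sum_Rflip_crossing (hq : q ≠ 0) {x : ℂ} (hx : x ≠ 0) (p f i l : Fin (M + N)) :
    ∑ a, ∑ j, strWeight q a * (-1) ^ (par a * (par p + par f)) *
      (Rflip q (x * q ^ (2 * ((M : ℤ) - N))) a p i j * Rmat q x f a j l)
      = if f = p ∧ i = l then crossing x (q ^ (2 * ((M : ℤ) - N))) * strWeight q p else 0 := by
  simp only [Rflip_mul_Rmat_diag, mul_add, Finset.sum_add_distrib, mul_ite, mul_zero]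
  simp only [Finset.sum_ite_eq, Finset.mem_univ, if_true]
  rw [← Finset.sum_add_distrib]
  by_cases hip : i = p
  · subst hip
    simp only [if_true, Rmat_inner]
    by_cases hfl : f = l
    · subst hfl
      simp only [if_true]
      refine Eq.trans (Finset.sum_congr rfl fun a _ => ?_)
        ((sum_crossing hq hx i f).trans (by simp [eq_comm]))
      by_cases ha : a = i
      · subst ha
        simp only [if_true, pow_add, Rmat_inner]
        ring
      · simp only [ha, if_false, pow_add]
        ring
    · have : ¬ (f = i ∧ i = l) := fun h => hfl (h.1.trans h.2)
      simp [hfl, this, Rmat_inner]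
  · simp only [hip, if_false, add_zero, Finset.sum_ite_eq',
      Finset.mem_univ, if_true, Rmat_of_ne x hip]
    split_ifs with h
    · rw [h.1, ← mul_add, ← two_mul, Even.neg_one_pow ⟨par p * par p, by ring⟩]
      simp only [diagWeight, hip, if_false, crossing, inv_inv]
      ring
    · simp

/-- Crossing in the opposite order: a one-sided inverse of a finite complex matrix is two-sided. The
matrices `X` and `Y` are the partial transposes, normalized so that `sum_Rflip_crossing` reads `X *
Y = 1`. -/
theorem sum_crossing_Rflip (hq : q ≠ 0) {x : ℂ} (hx : x ≠ 0)
    (hc : crossing x (q ^ (2 * ((M : ℤ) - N))) ≠ 0) (p c i l : Fin (M + N)) :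
    ∑ b, ∑ j, (-1) ^ (par c * par b + par p * par b) * (strWeight q b)⁻¹ *
      (Rmat q x b c i j * Rflip q (x * q ^ (2 * ((M : ℤ) - N))) p b j l)
      = if p = c ∧ i = l then
          crossing x (q ^ (2 * ((M : ℤ) - N))) * (strWeight q c)⁻¹ else 0 := by
  set s := q ^ (2 * ((M : ℤ) - N)) with hs
  let X : Matrix (Fin (M + N) × Fin (M + N)) (Fin (M + N) × Fin (M + N)) ℂ :=
    fun u v => (-1) ^ (par v.1 * par u.1) * (strWeight q u.1)⁻¹ * strWeight q v.1 *
      Rflip q (x * s) v.1 u.1 u.2 v.2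
  let Y : Matrix (Fin (M + N) × Fin (M + N)) (Fin (M + N) × Fin (M + N)) ℂ :=
    fun u v => (crossing x s)⁻¹ * (-1) ^ (par u.1 * par v.1) * Rmat q x v.1 u.1 u.2 v.2
  have hXY : X * Y = 1 := by
    ext ⟨p, i⟩ ⟨f, l⟩
    rw [Matrix.mul_apply, Fintype.sum_prod_type]
    have h := congrArg (fun z => (strWeight q p)⁻¹ * (crossing x s)⁻¹ * z)
      (sum_Rflip_crossing hq hx p f i l)
    simp only [Finset.mul_sum] at h
    refine Eq.trans (Finset.sum_congr rfl fun a _ => Finset.sum_congr rfl fun j _ => ?_)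
      (h.trans ?_)
    · simp only [X, Y, mul_add, pow_add, ← hs]; ring
    · have := strWeight_ne_zero hq p
      rw [Matrix.one_apply]
      by_cases hh : f = p ∧ i = l
      · rw [if_pos hh, if_pos (by rw [hh.1, hh.2]), ← hs]; field_simp
      · rw [if_neg hh, if_neg (by simpa [eq_comm] using hh), mul_zero]
  have hYX := mul_eq_one_comm.mp hXY
  have h := congrFun (congrFun hYX (c, i)) (p, l)
  rw [Matrix.mul_apply, Fintype.sum_prod_type] at h
  have h' := congrArg (fun z => crossing x s * (strWeight q p)⁻¹ * z) h
  simp only [Finset.mul_sum] at h'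
  have := strWeight_ne_zero hq p
  refine Eq.trans (Finset.sum_congr rfl fun a _ => Finset.sum_congr rfl fun j _ => ?_)
      (h'.trans ?_)
  · simp only [X, Y, pow_add]; field_simp
  · rw [Matrix.one_apply]
    by_cases hh : p = c ∧ i = l
    · rw [if_pos hh, if_pos (by rw [hh.1, hh.2]), hh.1]; ring
    · rw [if_neg hh, if_neg (by simpa [eq_comm] using hh), mul_zero]

end Scalars

/-! ### Moving the quantum supertrace through L₂, abstractly. -/

section Blocks

variable {ι 𝓜 : Type} [Fintype ι] [DecidableEq ι] [Ring 𝓜] [Algebra ℂ 𝓜]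

theorem neg_one_pow_mul_self (n : ℕ) : ((-1 : ℂ) ^ n) * (-1) ^ n = 1 := by
  rw [← pow_add, Even.neg_one_pow ⟨n, rfl⟩]

/-- The quantum supertrace of `L⁻¹(xs) L(x)` commutes with `L₂`, in terms of blocks. -/
theorem block_commute (π : ι → ℕ) (hπ : ∀ a, π a = 0 ∨ π a = 1)
    (R r rs u l : ι → ι → 𝓜) (Λ Z : 𝓜) (θ : ι → ℂ) (c ν : ℂ)
    (hθ : ∀ a, θ a ≠ 0) (hc : c ≠ 0) (hν : ν ≠ 0)
    (hR : ∀ a b, ∑ p, R a p * (l p b * Λ) = ∑ p, Λ * (l a p * R p b))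
    (hu : ∀ a b, ∑ p, u a p * (rs p b * Λ) = ∑ p, Λ * (rs a p * u p b))
    (hr : ∀ a b, ∑ p, r a p * R p b = if a = b then c • 1 else 0)
    (hur : ∀ a b e g, u a b * r e g = (-1 : ℂ) ^ ((π a + π b) * (π e + π g)) • (r e g * u a b))
    (hurs : ∀ a b e g, u a b * rs e g = (-1 : ℂ) ^ ((π a + π b) * (π e + π g)) • (rs e g * u a b))
    (huR : ∀ a b e g, u a b * R e g = (-1 : ℂ) ^ ((π a + π b) * (π e + π g)) • (R e g * u a b))
    (hlR : ∀ a b e g, l a b * R e g = (-1 : ℂ) ^ ((π a + π b) * (π e + π g)) • (R e g * l a b))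
    (hcr : ∀ p f, ∑ a, (θ a * (-1 : ℂ) ^ (π a * (π p + π f))) • (rs a p * R f a)
      = if f = p then (ν * θ p) • 1 else 0)
    (hrc : ∀ p d, ∑ b, ((-1 : ℂ) ^ (π d * π b + π p * π b) * (θ b)⁻¹) • (R b d * rs p b)
      = if p = d then (ν * (θ d)⁻¹) • 1 else 0)
    (hZ : ∀ d e, ∑ a, (θ a * (-1 : ℂ) ^ (π a * (π d + π e))) • (u a d * l e a)
      = if d = e then θ d • Z else 0) (d : ι) : Z * Λ = Λ * Z := by
  -- Unitarity inserts `r R` before `l Λ`, and the `RLL` relation then carries `Λ` to the left of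
  -- `l`.
  have s1 : ∀ e a, c • (l e a * Λ) = ∑ g, ∑ f, r e g * (Λ * (l g f * R f a)) := by
    intro e a
    calc c • (l e a * Λ) = ∑ p, (∑ g, r e g * R g p) * (l p a * Λ) := by simp [hr]
      _ = ∑ g, r e g * ∑ p, R g p * (l p a * Λ) := by
        simp only [Finset.sum_mul, Finset.mul_sum, mul_assoc]
        exact Finset.sum_comm
      _ = _ := by simp only [hR, Finset.mul_sum]
  -- Crossing inserts `R rs`, supercommutation brings `rs` to the right of `u`, and `hu` then
  -- carries `Λ` to the left of `u`.
  have s2 : ∀ a, (ν * (θ d)⁻¹) • (u a d * Λ) = ∑ b, ∑ p,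
      ((-1 : ℂ) ^ (π a * π b + π a * π d + π d + π d * π b) * (θ b)⁻¹) •
        (R b d * (Λ * (rs a p * u p b))) := by
    intro a
    calc (ν * (θ d)⁻¹) • (u a d * Λ)
        = ∑ p, (-1 : ℂ) ^ (π a * (π d + π p) + π d + π p) •
          ((∑ b, ((-1 : ℂ) ^ (π d * π b + π p * π b) * (θ b)⁻¹) • (R b d * rs p b))
            * (u a p * Λ)) := by
          simp only [hrc, ite_mul, zero_mul, smul_ite, smul_zero, Finset.sum_ite_eq',
            Finset.mem_univ, if_true, smul_mul_assoc, one_mul]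
          rw [Even.neg_one_pow ⟨π a * π d + π d, by ring⟩, one_smul]
      _ = ∑ b, ∑ p, ((-1 : ℂ) ^ (π a * π b + π a * π d + π d + π d * π b) * (θ b)⁻¹) •
            (R b d * (u a p * (rs p b * Λ))) := by
          simp only [Finset.sum_mul, Finset.smul_sum]
          rw [Finset.sum_comm]
          refine Finset.sum_congr rfl fun b _ => Finset.sum_congr rfl fun p _ => ?_
          rw [← mul_assoc (u a p), hurs]
          simp only [smul_mul_assoc, mul_smul_comm, smul_smul, mul_assoc]
          congr 1
          rcases hπ a with h1 | h1 <;> rcases hπ b with h2 | h2 <;> rcases hπ d with h3 | h3 <;>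
            rcases hπ p with h4 | h4 <;> norm_num [h1, h2, h3, h4]
      _ = _ := by
          refine Finset.sum_congr rfl fun b _ => ?_
          rw [← Finset.smul_sum, ← Finset.mul_sum, hu, Finset.mul_sum, Finset.smul_sum]
  -- Supercommutation puts `rs` and `R` side by side inside the product, so that the sum over `a`
  -- becomes an instance of crossing.
  have s3 : ∀ a g f, (ν * (θ d)⁻¹) • (u a d * (r d g * (Λ * (l g f * R f a)))) =
      ∑ b, ∑ p, ((-1 : ℂ) ^ (π a * (π p + π f) + (π b + π g) * π f + π p * π f + π f + π d * π g + π d * π b)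
        * (θ b)⁻¹) • (r d g * (R b d * (Λ * ((rs a p * R f a) * (u p b * l g f))))) := by
    intro a g f
    calc _ = (-1 : ℂ) ^ ((π a + π d) * (π d + π g)) •
          (r d g * (((ν * (θ d)⁻¹) • (u a d * Λ)) * (l g f * R f a))) := by
          rw [← mul_assoc (u a d), hur]
          simp only [smul_mul_assoc, mul_smul_comm, smul_smul, mul_assoc, mul_comm]
      _ = _ := by
          rw [s2]
          simp only [Finset.sum_mul, Finset.mul_sum, Finset.smul_sum]
          refine Finset.sum_congr rfl fun b _ => Finset.sum_congr rfl fun p _ => ?_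
          have e : u p b * (l g f * R f a) =
            (-1 : ℂ) ^ ((π p + π b + π g + π f) * (π f + π a)) •
              (R f a * (u p b * l g f)) := by
            rw [hlR, mul_smul_comm, ← mul_assoc, huR, smul_mul_assoc, smul_smul, ← pow_add,
              mul_assoc]
            congr 2
            ring
          simp only [smul_mul_assoc, mul_smul_comm, smul_smul, mul_assoc, e]
          congr 1
          rcases hπ a with h1 | h1 <;> rcases hπ b with h2 | h2 <;> rcases hπ d with h3 | h3 <;>
            rcases hπ p with h4 | h4 <;> rcases hπ f with h5 | h5 <;> rcases hπ g with h6 | h6 <;>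
            norm_num [h1, h2, h3, h4, h5, h6]
  -- After `s1` and `s3`, the inner pair `rs R` collapses by `hcr`, the remaining `u l` becomes `Z`
  -- by `hZ`, and the outer pair `r R` returns the constant `c`.
  have s4 : (ν * c) • (Z * Λ) = (ν * c) • (Λ * Z) := by
    calc (ν * c) • (Z * Λ)
        = (ν * (θ d)⁻¹) • ∑ a, θ a • (u a d * (c • (l d a * Λ))) := by
          have h := congrArg (fun z => (ν * (θ d)⁻¹ * c) • (z * Λ)) (hZ d d)
          simp only [if_true, smul_mul_assoc, smul_smul] at h
          rw [show ν * c = ν * (θ d)⁻¹ * c * θ d by field_simp [hθ d], ← h]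
          simp only [Finset.sum_mul, Finset.smul_sum, smul_smul, smul_mul_assoc, mul_smul_comm,
            mul_assoc]
          refine Finset.sum_congr rfl fun a _ => ?_
          rw [Even.neg_one_pow ⟨π a * π d, by ring⟩]
          congr 1
          ring
      _ = ∑ a, ∑ g, ∑ f, θ a • ((ν * (θ d)⁻¹) • (u a d * (r d g * (Λ * (l g f * R f a))))) := by
          simp only [s1, Finset.mul_sum, Finset.smul_sum, smul_smul, mul_comm]
      _ = ∑ g, ∑ b, ∑ f, ∑ p,
          ((-1 : ℂ) ^ ((π b + π g) * π f + π p * π f + π f + π d * π g + π d * π b) *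
            (θ b)⁻¹) •
          (r d g * (R b d * (Λ *
            ((∑ a, (θ a * (-1 : ℂ) ^ (π a * (π p + π f))) • (rs a p * R f a))
              * (u p b * l g f))))) := by
          simp only [s3, Finset.sum_mul, Finset.mul_sum, Finset.smul_sum, smul_smul,
            smul_mul_assoc, mul_smul_comm]
          rw [Finset.sum_comm]
          refine Finset.sum_congr rfl fun g _ => ?_
          rw [Finset.sum_comm]
          conv_rhs => rw [Finset.sum_comm]
          refine Finset.sum_congr rfl fun f _ => ?_
          rw [Finset.sum_comm]
          refine Finset.sum_congr rfl fun b _ => ?_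
          rw [Finset.sum_comm]
          refine Finset.sum_congr rfl fun p _ => Finset.sum_congr rfl fun a _ => ?_
          congr 1
          simp only [pow_add]
          ring
      _ = ∑ g, ∑ b, (ν * ((-1 : ℂ) ^ (π d * π g + π d * π b) * (θ b)⁻¹)) •
          (r d g * (R b d * (Λ *
            ∑ f, (θ f * (-1 : ℂ) ^ (π f * (π b + π g))) • (u f b * l g f)))) := by
          simp only [hcr, ite_mul, zero_mul, mul_ite, mul_zero, smul_ite, smul_zero,
            Finset.sum_ite_eq, Finset.mem_univ, if_true, smul_mul_assoc, mul_smul_comm, one_mul,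
            smul_smul, Finset.mul_sum, Finset.smul_sum]
          refine Finset.sum_congr rfl fun g _ => Finset.sum_congr rfl fun b _ =>
            Finset.sum_congr rfl fun f _ => ?_
          congr 1
          rw [mul_comm (π f)]
          rcases hπ f with h5 | h5 <;> simp only [h5, pow_add] <;> ring
      _ = ∑ b, ν • ((r d b * R b d) * (Λ * Z)) := by
          simp only [hZ, mul_ite, mul_zero, smul_ite, smul_zero, mul_smul_comm, smul_smul]
          rw [Finset.sum_comm]
          simp only [Finset.sum_ite_eq, Finset.mem_univ, if_true, mul_assoc]
          refine Finset.sum_congr rfl fun b _ => ?_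
          congr 1
          have h := neg_one_pow_mul_self (π d * π b)
          have := hθ b
          field_simp
          simp only [pow_add]
          linear_combination h
      _ = _ := by
          rw [← Finset.smul_sum, ← Finset.sum_mul, hr, if_pos rfl, smul_mul_assoc, one_mul,
            smul_smul]
  have h := congrArg (fun z => (ν * c)⁻¹ • z) s4
  simpa [smul_smul, hc, hν] using h

end Blocks

/-! ### Degeneration at x = q^(2(M-N)): the partial transposes are inverse up to one series. -/

section RankOne

variable {M N : ℕ} {B : Type} [Ring B] [Algebra ℂ B]

/-- A scalar matrix acting on the second factor of `V ⊗ V`. -/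
def scal (B : Type) [Ring B] [Algebra ℂ B] (r : Fin (M + N) → Fin (M + N) → ℂ) :
    Matrix (Fin (M + N)) (Fin (M + N)) B := fun i j => algebraMap ℂ B (r i j)

/-- The blocks of `X₁`, as matrices acting on the second factor of `V ⊗ V`. -/
def blk (X : Matrix (Fin (M + N)) (Fin (M + N)) B) (a b : Fin (M + N)) :
    Matrix (Fin (M + N)) (Fin (M + N)) B :=
  Matrix.diagonal fun c => ((-1 : ℂ) ^ ((par a + par b) * par c)) • X a b

theorem sum_blk_mul_blk (X Y : Matrix (Fin (M + N)) (Fin (M + N)) B) (a b : Fin (M + N)) :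
    ∑ p, blk X a p * blk Y p b = blk (X * Y) a b := by
  simp only [blk, Matrix.diagonal_mul_diagonal]
  ext i j
  rw [Matrix.sum_apply]
  by_cases h : i = j
  · subst h
    simp only [Matrix.diagonal_apply_eq, Matrix.mul_apply, Finset.smul_sum]
    refine Finset.sum_congr rfl fun p _ => ?_
    rw [smul_mul_smul_comm, ← pow_add]
    congr 1
    rw [show (par a + par p) * par i + (par p + par b) * par i
      = (par a + par b) * par i + 2 * (par p * par i) by ring, pow_add, pow_mul]
    simp
  · simp [h]

theorem blk_one (a b : Fin (M + N)) :
    blk (1 : Matrix (Fin (M + N)) (Fin (M + N)) B) a b = if a = b then 1 else 0 := by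
  unfold blk
  by_cases h : a = b
  · subst h
    have : ∀ c : Fin (M + N), (-1 : ℂ) ^ ((par a + par a) * par c) = 1 := fun c =>
      Even.neg_one_pow ⟨par a * par c, by ring⟩
    simp [this]
  · simp [h]

theorem Rmat_even (q x : ℂ) (a b c d : Fin (M + N)) :
    (-1) ^ (par a + par b) * Rmat q x a b c d = (-1) ^ (par c + par d) * Rmat q x a b c d := by
  unfold Rmat
  split_ifs <;> simp_all [add_comm]

theorem Rmat_sign (q x : ℂ) (a b c d : Fin (M + N)) :
    (-1) ^ (par a * par c) * Rmat q x a b c d = (-1) ^ (par b * par d) * Rmat q x a b c d := by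
  unfold Rmat
  split_ifs <;> simp_all [mul_comm]

/-- The entries of `r` are scalars, so the sign comes only from the diagonal signs of `blk`; `hr`
says that `r` is homogeneous of parity [e] + [g]. -/
theorem blk_mul_scal (X : Matrix (Fin (M + N)) (Fin (M + N)) B)
    (r : Fin (M + N) → Fin (M + N) → ℂ) (a b e g : Fin (M + N))
    (hr : ∀ c d, (-1) ^ (par e + par g) * r c d = (-1) ^ (par c + par d) * r c d) :
    blk X a b * scal B r = (-1 : ℂ) ^ ((par a + par b) * (par e + par g)) • (scal B r * blk X a b)
    := by
  ext c d
  simp only [blk, scal, Matrix.diagonal_mul, Matrix.mul_diagonal, Matrix.smul_apply,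
    smul_mul_assoc, mul_smul_comm, smul_smul]
  rw [← Algebra.commutes, ← Algebra.smul_def, smul_smul, smul_smul]
  congr 1
  have h := hr c d
  have hd := neg_one_pow_mul_self (par d)
  rw [pow_add _ (par c)] at h
  rcases par_eq_zero_or_one a with h1 | h1 <;> rcases par_eq_zero_or_one b with h2 | h2 <;>
    simp only [h1, h2, zero_add, add_zero, zero_mul, one_mul, pow_zero, Nat.reduceAdd, pow_mul,
      neg_one_sq, one_pow]
  all_goals first
    | ring1
    | linear_combination (-(-1) ^ par d) * h - ((-1) ^ par c * r c d) * hd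

theorem Rmat_outer (q x : ℂ) (b j p : Fin (M + N)) :
    Rmat q x b j p b
      = if j = p then (if p = b then diagWeight q x b p else 0) + flipWeight q x b p else 0 := by
  unfold Rmat
  by_cases hj : j = p
  · subst hj
    by_cases hb : b = j
    · subst hb; simp
    · simp [hb, Ne.symm hb]
  · by_cases hb : b = j
    · subst hb; simp [hj, Ne.symm hj]
    · simp [hb, hj, Ne.symm hj]

theorem Rmat_outer_of_ne (q x : ℂ) {i b : Fin (M + N)} (h : i ≠ b) (j p : Fin (M + N)) :
    Rmat q x i j p b = if i = j then if p = b then 1 - x⁻¹ else 0 else 0 := by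
  unfold Rmat diagWeight
  by_cases hp : p = b
  · subst hp; simp [h]
  · simp [h, hp]

/-- The steps at two adjacent indices differ at a single point, so subtracting adjacent rows of the
linear system for the diagonal sums leaves only two unknowns. -/
theorem step_sub_step (z : ℂ) (P : ℕ → ℂ) (b c p : Fin (M + N)) (hbc : (c : ℕ) = b + 1) :
    (step z b p * P p - step z b (p + 1) * P (p + 1))
      - (step z c p * P p - step z c (p + 1) * P (p + 1))
      = (z - 1) * P c * ((if p = c then 1 else 0) - if p = b then 1 else 0) := by
  have h : ∀ k : ℕ, step z b k - step z c k = if k = c then z - 1 else 0 := by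
    intro k
    unfold step
    by_cases h1 : k ≤ b
    · rw [if_pos h1, if_pos (by omega), if_neg (by omega), sub_self]
    · by_cases h2 : k = c
      · rw [if_neg h1, if_pos (by omega), if_pos h2]
      · rw [if_neg h1, if_neg (by omega), if_neg h2, sub_self]
  have e : (step z b p * P p - step z b (p + 1) * P (p + 1))
      - (step z c p * P p - step z c (p + 1) * P (p + 1))
      = (step z b p - step z c p) * P p - (step z b (p + 1) - step z c (p + 1)) * P (p + 1) := by
    ring
  rw [e, h, h]
  by_cases h1 : p = c
  · subst h1
    have h2 : p ≠ b := fun e => by rw [e] at hbc; omega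
    simp [h2]
  · have h1' : (p : ℕ) ≠ c := fun e => h1 (Fin.ext e)
    by_cases h2 : p = b
    · subst h2
      simp [h1, h1', ← hbc]
    · have h2' : (p : ℕ) + 1 ≠ c := fun e => h2 (Fin.ext (by omega))
      simp [h1, h2, h1', h2']

set_option maxHeartbeats 1000000 in
/-- The partial transposes of `L⁻¹(x q^(2(M-N)))` and `L(x)` are inverse to each other up to
a factor `Z`. -/
theorem exists_transpose_inverse {q : ℂ} (hq : q ≠ 0) (hs : q ^ (2 * ((M : ℤ) - N)) ≠ 1)
    (U L : Matrix (Fin (M + N)) (Fin (M + N)) B)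
    (hu : ∀ a b,
      ∑ p, blk U a p * (scal B (fun i j => Rflip q (q ^ (2 * ((M : ℤ) - N))) p b i j) * L)
      = ∑ p, L * (scal B (fun i j => Rflip q (q ^ (2 * ((M : ℤ) - N))) a p i j) * blk U p b)) :
    ∃ Z : B, ∀ d e, ∑ a, (strWeight q a * (-1 : ℂ) ^ (par a * (par d + par e))) • (U a d * L e a)
      = if d = e then strWeight q d • Z else 0 := by
  set s := q ^ (2 * ((M : ℤ) - N)) with hsdef
  -- Take the entry `(i, a)` of `hu a b`, weight it by `strWeight q a` and a sign, and sum over `a`.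
  -- On the right the sum over `a` meets only `R`, and vanishes by `sum_strWeight_mul_flip`.
  have main : ∀ b i, ∑ a, ∑ p, ∑ j, (strWeight q a * (-1) ^ (par a * par b) *
      (-1) ^ ((par a + par p) * par i) * Rmat q s⁻¹ i j p b) • (U a p * L j a) = 0 := by
    intro b i
    have h : ∀ a, ∑ p, ∑ j, (strWeight q a * (-1) ^ (par a * par b) *
      (-1) ^ ((par a + par p) * par i) * Rmat q s⁻¹ i j p b) • (U a p * L j a)
      = ∑ p, ∑ j, (strWeight q a * (-1) ^ (par a * par b) *
      (-1) ^ ((par p + par b) * par a) * Rmat q s⁻¹ j a a p) • (L i j * U p b) := by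
      intro a
      have h := congrArg (fun z => (strWeight q a * (-1 : ℂ) ^ (par a * par b)) • z)
        (congrFun (congrFun (hu a b) i) a)
      simp only [Matrix.sum_apply, blk, Matrix.diagonal_mul, Finset.smul_sum] at h
      simp only [Matrix.mul_apply, scal, Rflip, ← Algebra.smul_def,
        Finset.mul_sum, Finset.smul_sum, smul_smul, smul_mul_assoc, mul_smul_comm,
        Matrix.diagonal_apply, mul_ite, mul_zero, Finset.sum_ite_eq', Finset.mem_univ, if_true] at h
      refine Eq.trans (Finset.sum_congr rfl fun p _ => Finset.sum_congr rfl fun j _ => ?_)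
        (h.trans (Finset.sum_congr rfl fun p _ => Finset.sum_congr rfl fun j _ => ?_))
      · congr 1; ring
      · congr 1; ring
    simp only [h]
    rw [Finset.sum_comm]
    refine Finset.sum_eq_zero fun p _ => ?_
    rw [Finset.sum_comm]
    refine Finset.sum_eq_zero fun j _ => ?_
    rw [← Finset.sum_smul]
    simp only [Rmat_inner]
    by_cases hjp : j = p
    · subst hjp
      have h0 := sum_strWeight_mul_flip (M := M) (N := N) hq j
      rw [← hsdef] at h0
      rw [show (∑ a, _ : ℂ) = 0 from Eq.trans (Finset.sum_congr rfl fun a _ => ?_) h0, zero_smul]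
      simp only [if_true, eq_comm]
      rcases par_eq_zero_or_one a with h1 | h1 <;> rcases par_eq_zero_or_one b with h2 | h2 <;>
        simp [h1, h2] <;> ring
    · simp [hjp]
  -- For `i ≠ b` the only surviving entry of `R` in `main` is the diagonal one, `1 - s`, which can
  -- be divided out.
  have hoff : ∀ d e, d ≠ e →
      ∑ a, (strWeight q a * (-1 : ℂ) ^ (par a * (par d + par e))) • (U a d * L e a) = 0 := by
    intro b i hbi
    have h := main b i
    simp only [Rmat_outer_of_ne q s⁻¹ hbi.symm, inv_inv, mul_ite, mul_zero, ite_smul, zero_smul, Finset.sum_ite_eq, Finset.sum_ite_eq',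
      Finset.mem_univ, if_true] at h
    have h' := congrArg (fun z => ((1 - s)⁻¹ * (-1) ^ (par b * par i)) • z) h
    simp only [Finset.smul_sum, smul_smul, smul_zero] at h'
    refine Eq.trans (Finset.sum_congr rfl fun a _ => ?_) h'
    congr 1
    have : 1 - s ≠ 0 := sub_ne_zero.mpr (Ne.symm hs)
    have h2 := neg_one_pow_mul_self (par b * par i)
    field_simp
    simp only [mul_add, add_mul, pow_add]
    linear_combination (-strWeight q a * (-1) ^ (par a * par b) * (-1) ^ (par a * par i)) * h2
  -- The candidates for `Z` read off from the diagonal. The case `i = b` of `main` is a linear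
  -- system for them, and differences of its adjacent rows give `W c = W b`.
  let W : Fin (M + N) → B := fun d => (strWeight q d)⁻¹ • ∑ a, strWeight q a • (U a d * L d a)
  have hW : ∀ b : Fin (M + N), ∑ p : Fin (M + N), (step s b p * qPartial M N q p
      - step s b (p + 1) * qPartial M N q (p + 1)) • W p = 0 := by
    intro b
    refine Eq.trans ?_ (main b b)
    conv_rhs => rw [Finset.sum_comm]
    refine Finset.sum_congr rfl fun p _ => ?_
    rw [← strWeight_mul_flip hq]
    simp only [W, Rmat_outer, mul_ite, mul_zero, ite_smul, zero_smul, Finset.sum_ite_eq',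
      Finset.mem_univ, if_true, Finset.smul_sum, smul_smul]
    refine Finset.sum_congr rfl fun a _ => ?_
    congr 1
    have := strWeight_ne_zero hq p
    generalize (if p = b then diagWeight q s⁻¹ b p else 0) + flipWeight q s⁻¹ b p = D
    have h2 := neg_one_pow_mul_self (par a * par b)
    field_simp
    simp only [add_mul, pow_add]
    linear_combination (-strWeight q a * (-1) ^ (par p * par b) * D) * h2
  have hstep : ∀ b c : Fin (M + N), (c : ℕ) = b + 1 → W c = W b := by
    intro b c hbc
    have h : ∑ p : Fin (M + N), ((s - 1) * qPartial M N q c) •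
        ((if p = c then W p else 0) - (if p = b then W p else 0)) = 0 := by
      refine Eq.trans ?_ (sub_eq_zero_of_eq ((hW b).trans (hW c).symm))
      rw [← Finset.sum_sub_distrib]
      refine Finset.sum_congr rfl fun p _ => ?_
      rw [← sub_smul, step_sub_step s (qPartial M N q) b c p hbc, mul_smul ((s - 1) * _)]
      congr 1
      rw [sub_smul, ite_smul, ite_smul, one_smul, zero_smul]
    rw [← Finset.smul_sum, Finset.sum_sub_distrib] at h
    simp only [Finset.sum_ite_eq', Finset.mem_univ, if_true] at h
    have h0 : (s - 1) * qPartial M N q c ≠ 0 :=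
      mul_ne_zero (sub_ne_zero.mpr hs) (zpow_ne_zero _ hq)
    exact sub_eq_zero.mp ((smul_eq_zero.mp h).resolve_left h0)
  have hconst : ∀ k (hk : k < M + N), W ⟨k, hk⟩ = W ⟨0, by omega⟩ := by
    intro k
    induction k with
    | zero => intro _; rfl
    | succ k ih => intro hk; exact (hstep ⟨k, by omega⟩ ⟨k + 1, hk⟩ rfl).trans (ih _)
  -- The default value 0 concerns only `M + N = 0`, where there is no index and nothing to prove.
  refine ⟨if h : 0 < M + N then W ⟨0, h⟩ else 0, fun d e => ?_⟩
  by_cases hde : d = e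
  · subst hde
    have hd : 0 < M + N := by have := d.2; omega
    rw [if_pos rfl, dif_pos hd, ← hconst d d.2]
    simp only [W, smul_smul, mul_inv_cancel₀ (strWeight_ne_zero hq d), one_smul]
    refine Finset.sum_congr rfl fun a _ => ?_
    rw [Even.neg_one_pow ⟨par a * par d, by ring⟩, mul_one]
  · rw [if_neg hde, hoff d e hde]

end RankOne

/-! ### From graded tensor products to ordinary matrices. -/

section Twist

variable {M N : ℕ} {A : Type} [Ring A]

/-- Even elements of `End V ⊗ A` as matrices. -/
def tw1 (X : Op1 M N A) : Matrix (Fin (M + N)) (Fin (M + N)) A :=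
  fun a b => (-1) ^ ((par a + par b) * par b) * X a b

theorem sign_mul_sign (i j : ℕ) (x y : A) :
    ((-1) ^ i * x) * ((-1) ^ j * y) = (-1) ^ (i + j) * (x * y) := by
  rcases neg_one_pow_eq_or A i with h | h <;> rcases neg_one_pow_eq_or A j with h' | h' <;>
    simp [pow_add, h, h']

theorem neg_one_pow_congr {m n : ℕ} (h : m % 2 = n % 2) : (-1 : A) ^ m = (-1) ^ n := by
  rw [neg_one_pow_eq_pow_mod_two, h, ← neg_one_pow_eq_pow_mod_two]

theorem sign_sq (k : ℕ) (x : A) : (-1) ^ k * ((-1) ^ k * x) = x := by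
  rw [← mul_assoc, ← pow_add, Even.neg_one_pow ⟨k, rfl⟩, one_mul]

/-- The sign in `tw1` is that of e^a_b ⊗ x acting on v^b, where x of parity [a] + [b] passes v^b;
composition of operators then becomes the matrix product. -/
theorem tw1_mul1 (X Y : Op1 M N A) : tw1 (mul1 X Y) = tw1 X * tw1 Y := by
  ext a b
  simp only [tw1, mul1, Matrix.mul_apply, Finset.mul_sum]
  refine Finset.sum_congr rfl fun p _ => ?_
  rw [sign_mul_sign, ← mul_assoc, ← pow_add]
  congr 1
  apply neg_one_pow_congr
  rcases par_eq_zero_or_one a with h1 | h1 <;> rcases par_eq_zero_or_one b with h2 | h2 <;>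
    rcases par_eq_zero_or_one p with h3 | h3 <;> simp only [h1, h2, h3]

theorem tw1_one1 : tw1 (one1 : Op1 M N A) = 1 := by
  ext a b
  unfold tw1 one1
  by_cases h : a = b
  · subst h
    rw [Even.neg_one_pow ⟨par a * par a, by ring⟩]
    simp
  · simp [h]

theorem tw1_injective : Function.Injective (tw1 : Op1 M N A → _) := by
  intro X Y h
  funext a b
  have := congrArg (fun z => (-1) ^ ((par a + par b) * par b) * z) (congrFun (congrFun h a) b)
  simpa only [tw1, sign_sq] using this

theorem exists_tw1_eq (X : Matrix (Fin (M + N)) (Fin (M + N)) A) :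
    ∃ Y : Op1 M N A, tw1 Y = X := by
  refine ⟨fun a b => (-1) ^ ((par a + par b) * par b) * X a b, ?_⟩
  ext a b
  simp only [tw1, sign_sq]

theorem isInv1_iff (X Y : Op1 M N A) :
    IsInv1 X Y ↔ tw1 X * tw1 Y = 1 ∧ tw1 Y * tw1 X = 1 := by
  unfold IsInv1
  rw [← tw1_mul1, ← tw1_mul1, ← tw1_one1, tw1_injective.eq_iff, tw1_injective.eq_iff]

/-- Even elements of `End V ⊗ End V ⊗ A` as matrices. -/
def tw2 : Op2 M N A →+
    Matrix (Fin (M + N) × Fin (M + N)) (Fin (M + N) × Fin (M + N)) A where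
  toFun X := fun u v => (-1) ^ ((par u.1 + par v.1) * par v.1
    + (par u.1 + par v.1 + par u.2 + par v.2) * par v.2) * X u.1 v.1 u.2 v.2
  map_zero' := by ext u v; simp
  map_add' X Y := by funext u v; exact mul_add _ _ _

theorem tw2_apply (X : Op2 M N A) (u v : Fin (M + N) × Fin (M + N)) :
    tw2 X u v = (-1) ^ ((par u.1 + par v.1) * par v.1
    + (par u.1 + par v.1 + par u.2 + par v.2) * par v.2) * X u.1 v.1 u.2 v.2 := rfl

theorem tw2_mul2 (X Y : Op2 M N A) : tw2 (mul2 X Y) = tw2 X * tw2 Y := by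
  ext ⟨a, c⟩ ⟨b, d⟩
  simp only [tw2_apply, mul2, Matrix.mul_apply, Finset.mul_sum, Fintype.sum_prod_type]
  refine Finset.sum_congr rfl fun p _ => Finset.sum_congr rfl fun r _ => ?_
  rw [sign_mul_sign, ← mul_assoc, ← pow_add]
  congr 1
  apply neg_one_pow_congr
  rcases par_eq_zero_or_one a with h1 | h1 <;> rcases par_eq_zero_or_one b with h2 | h2 <;>
    rcases par_eq_zero_or_one p with h3 | h3 <;> rcases par_eq_zero_or_one c with h4 | h4 <;>
    rcases par_eq_zero_or_one d with h5 | h5 <;> rcases par_eq_zero_or_one r with h6 | h6 <;>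
    simp only [h1, h2, h3, h4, h5, h6]

/-- The sign that remains is that of an entry of `X` passing the second tensor factor; it is the
sign built into `blk`. -/
theorem tw2_leg1 (X : Op1 M N A) (u v : Fin (M + N) × Fin (M + N)) :
    tw2 (leg1 X) u v
      = if u.2 = v.2 then (-1) ^ ((par u.1 + par v.1) * par u.2) * tw1 X u.1 v.1 else 0 := by
  rw [tw2_apply]
  unfold leg1 tw1
  split_ifs with h
  · rw [h, ← mul_assoc, ← pow_add]
    congr 1
    apply neg_one_pow_congr
    rcases par_eq_zero_or_one u.1 with h1 | h1 <;> rcases par_eq_zero_or_one v.1 with h2 | h2 <;>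
    rcases par_eq_zero_or_one v.2 with h3 | h3 <;> simp only [h1, h2, h3]
  · simp

theorem tw2_leg2 (X : Op1 M N A) (u v : Fin (M + N) × Fin (M + N)) :
    tw2 (leg2 X) u v = if u.1 = v.1 then tw1 X u.2 v.2 else 0 := by
  rw [tw2_apply]
  unfold leg2 tw1
  split_ifs with h
  · rw [h]
    congr 1
    apply neg_one_pow_congr
    rcases par_eq_zero_or_one u.2 with h1 | h1 <;> rcases par_eq_zero_or_one v.1 with h2 | h2 <;>
    rcases par_eq_zero_or_one v.2 with h3 | h3 <;> simp only [h1, h2, h3]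
  · simp

variable [Algebra ℂ A]

/-- The twist changes (-1)^[b] in the flip terms into the symmetric sign (-1)^([a][b]) of
`flipWeight`. -/
theorem tw2_RcoefA (q x : ℂ) (u v : Fin (M + N) × Fin (M + N)) :
    (tw2 (RcoefA q 0 : Op2 M N A) + x⁻¹ • tw2 (RcoefA q 1 : Op2 M N A)) u v
      = algebraMap ℂ A (Rmat q x u.1 v.1 u.2 v.2) := by
  obtain ⟨a, c⟩ := u
  obtain ⟨b, d⟩ := v
  rw [Matrix.add_apply, Matrix.smul_apply, tw2_apply, tw2_apply]
  have e : ∀ k : ℕ, (-1 : A) ^ k = algebraMap ℂ A ((-1) ^ k) := fun k => by simp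
  simp only [RcoefA, e, ← map_mul, Algebra.smul_def, ← map_add]
  congr 1
  simp only [Rcoef, Rmat, diagWeight, flipWeight]
  by_cases h1 : a = b
  · subst h1
    by_cases h2 : c = d
    · subst h2
      rw [Even.neg_one_pow ⟨par a * par a + (par a + par c) * par c, by ring⟩]
      simp
      split_ifs <;> simp_all <;> ring
    · have : ¬ (a = d ∧ a = c) := fun h => h2 (h.2.symm.trans h.1)
      by_cases h3 : a = d
      · subst h3; simp [h2, Ne.symm h2]
      · simp [h2, h3]
  · by_cases h2 : a = d ∧ b = c
    · obtain ⟨rfl, rfl⟩ := h2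
      rcases lt_or_gt_of_ne h1 with h | h <;>
      rcases par_eq_zero_or_one a with h3 | h3 <;> rcases par_eq_zero_or_one b with h4 | h4 <;>
        simp [h1, h, not_lt_of_gt h, h3, h4, Ne.symm h1] <;> ring
    · have h2' : a = d → ¬ c = b := fun h h' => h2 ⟨h, h'.symm⟩
      by_cases h3 : a = d
      · subst h3
        have := h2' rfl
        simp [h1, this, Ne.symm this]
      · simp [h1, h3]

end Twist

/-! ### Substitutions x⁻¹ ↦ t x⁻¹ in power series. -/

section Rescale

variable {A : Type} [Ring A] [Algebra ℂ A]

theorem coeff_complex_smul (c : ℂ) (f : PowerSeries A) (k : ℕ) :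
    PowerSeries.coeff k (c • f) = c • PowerSeries.coeff k f := rfl

/-- The substitution of `t x⁻¹` for `x⁻¹`. -/
def rescaleHom (t : ℂ) : PowerSeries A →ₐ[ℂ] PowerSeries A :=
  AlgHom.ofLinearMap
    { toFun := fun f => PowerSeries.mk fun k => t ^ k • PowerSeries.coeff k f
      map_add' := fun f g => by ext k; simp
      map_smul' := fun c f => by
        ext k
        simp only [PowerSeries.coeff_mk, RingHom.id_apply, coeff_complex_smul]
        rw [smul_comm] }
    (by
      ext k
      simp only [LinearMap.coe_mk, AddHom.coe_mk, PowerSeries.coeff_mk, PowerSeries.coeff_one]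
      split_ifs with h <;> simp [h])
    (fun f g => by
      ext k
      simp only [LinearMap.coe_mk, AddHom.coe_mk, PowerSeries.coeff_mk, PowerSeries.coeff_mul,
        Finset.smul_sum]
      refine Finset.sum_congr rfl fun x hx => ?_
      rw [smul_mul_smul_comm, ← pow_add, Finset.HasAntidiagonal.mem_antidiagonal.mp hx])

theorem coeff_rescaleHom (t : ℂ) (f : PowerSeries A) (k : ℕ) :
    PowerSeries.coeff k (rescaleHom t f) = t ^ k • PowerSeries.coeff k f := by
  simp [rescaleHom]

theorem rescaleHom_rescaleHom (s t : ℂ) (f : PowerSeries A) :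
    rescaleHom s (rescaleHom t f) = rescaleHom (s * t) f := by
  ext k
  simp only [coeff_rescaleHom, smul_smul, mul_pow]

theorem rescaleHom_one (f : PowerSeries A) : rescaleHom 1 f = f := by
  ext k
  simp [coeff_rescaleHom]

/-- A polynomial with coefficients in a vector space and infinitely many zeros vanishes. -/
theorem eq_zero_of_infinite_zeros {E : Type} [AddCommGroup E] [Module ℂ E] (n : ℕ) (c : ℕ → E)
    (h : {t : ℂ | ∑ k ∈ Finset.range n, t ^ k • c k = 0}.Infinite) {k : ℕ} (hk : k < n) :
    c k = 0 := by
  rw [← Module.forall_dual_apply_eq_zero_iff ℂ]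
  intro f
  let P : Polynomial ℂ := ∑ j ∈ Finset.range n, Polynomial.C (f (c j)) * Polynomial.X ^ j
  have hP : P = 0 := by
    apply Polynomial.eq_zero_of_infinite_isRoot
    refine h.mono fun t ht => ?_
    have := congrArg f ht
    simp only [map_sum, map_smul, map_zero, smul_eq_mul] at this
    simp only [Set.mem_ofPred_eq, Polynomial.IsRoot, P, Polynomial.eval_finsetSum,
      Polynomial.eval_mul, Polynomial.eval_C, Polynomial.eval_pow, Polynomial.eval_X]
    rw [← this]
    exact Finset.sum_congr rfl fun _ _ => mul_comm _ _
  have := congrArg (fun p => Polynomial.coeff p k) hP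
  simpa [P, Polynomial.finsetSum_coeff, Polynomial.coeff_C_mul, Polynomial.coeff_X_pow, hk]
    using this

end Rescale

/-! ### The `RLL` relation at a numerical spectral parameter. -/

section Relations

variable {M N : ℕ} {A : Type} [Ring A] [Algebra ℂ A]

/-- Since m ≤ 1 and kl.1 ≤ j, every exponent m + kl.1 lies below j + 2, so the truncated sum over
`i` loses nothing. -/
theorem sum_pow_smul_ite {E : Type} [AddCommGroup E] [Module ℂ E] (t : ℂ) (j : ℕ)
    (Y : ℕ → ℕ × ℕ → E) :
    ∑ i ∈ Finset.range (j + 2), t ^ i • ∑ m ∈ Finset.range 2,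
      ∑ kl ∈ Finset.HasAntidiagonal.antidiagonal j, (if m + kl.1 = i then Y m kl else 0)
    = ∑ m ∈ Finset.range 2, ∑ kl ∈ Finset.HasAntidiagonal.antidiagonal j,
        t ^ (m + kl.1) • Y m kl := by
  simp only [Finset.smul_sum, smul_ite, smul_zero]
  rw [Finset.sum_comm]
  refine Finset.sum_congr rfl fun m hm => ?_
  rw [Finset.sum_comm]
  refine Finset.sum_congr rfl fun kl hkl => ?_
  have h1 := Finset.mem_range.mp hm
  have h2 := Finset.HasAntidiagonal.mem_antidiagonal.mp hkl
  rw [Finset.sum_ite_eq, if_pos (Finset.mem_range.mpr (by omega))]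

variable {q : ℂ} {T : Fin (M + N) → Fin (M + N) → ℕ → A}

/-- For a fixed power of y⁻¹ the relation is polynomial in x⁻¹, so x⁻¹ may be replaced by a complex
number `t`. From here on x is a number and only y is formal. -/
theorem rll_sum (h : ∀ i j, rllLeft q T i j = rllRight q T i j) (t : ℂ) (j : ℕ) :
    (tw2 (RcoefA q 0 : Op2 M N A) + t • tw2 (RcoefA q 1 : Op2 M N A)) *
      ∑ kl ∈ Finset.HasAntidiagonal.antidiagonal j,
        t ^ kl.1 • (tw2 (leg1 (Lcoef T kl.1)) * tw2 (leg2 (Lcoef T kl.2)))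
    = (∑ kl ∈ Finset.HasAntidiagonal.antidiagonal j,
        t ^ kl.1 • (tw2 (leg2 (Lcoef T kl.2)) * tw2 (leg1 (Lcoef T kl.1)))) *
      (tw2 (RcoefA q 0 : Op2 M N A) + t • tw2 (RcoefA q 1 : Op2 M N A)) := by
  have h1 : ∑ i ∈ Finset.range (j + 2), t ^ i • tw2 (rllLeft q T i j)
      = ∑ i ∈ Finset.range (j + 2), t ^ i • tw2 (rllRight q T i j) := by simp only [h]
  simp only [rllLeft, rllRight, map_sum, apply_ite tw2, map_zero, tw2_mul2] at h1
  rw [sum_pow_smul_ite t j fun m kl => tw2 (RcoefA q m) * tw2 (leg1 (Lcoef T kl.1)) *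
      tw2 (leg2 (Lcoef T kl.2)),
    sum_pow_smul_ite t j fun m kl => tw2 (leg2 (Lcoef T kl.2)) * tw2 (leg1 (Lcoef T kl.1)) *
      tw2 (RcoefA q m)] at h1
  simp only [Finset.sum_range_succ, Finset.range_zero, Finset.sum_empty, zero_add] at h1
  simp only [add_mul, mul_add, Finset.mul_sum, Finset.sum_mul, smul_mul_assoc, mul_smul_comm,
    Finset.sum_add_distrib, smul_add, Finset.smul_sum, smul_smul, pow_add, pow_one, mul_assoc,
    mul_comm t] at h1 ⊢
  exact h1

omit [Algebra ℂ A] in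
theorem coeff_tw1_Lser (k : ℕ) (a b : Fin (M + N)) :
    PowerSeries.coeff k (tw1 (Lser T) a b) = tw1 (Lcoef T k) a b := by
  unfold tw1 Lser
  rcases neg_one_pow_eq_or (PowerSeries A) ((par a + par b) * par b) with h | h <;>
  rcases neg_one_pow_eq_or A ((par a + par b) * par b) with h' | h' <;>
  rcases par_eq_zero_or_one a with h1 | h1 <;> rcases par_eq_zero_or_one b with h2 | h2 <;>
  simp [h1, h2]

theorem neg_one_pow_mul_eq_smul (k : ℕ) (x : A) : (-1) ^ k * x = ((-1 : ℂ) ^ k) • x := by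
  rcases neg_one_pow_eq_or A k with h | h <;> rcases Nat.even_or_odd k with h' | h' <;>
    simp [h'.neg_one_pow]

theorem rll_series (h : ∀ i j, rllLeft q T i j = rllRight q T i j) (x : ℂ)
    (a b c d : Fin (M + N)) :
    ∑ p, ∑ r, (Rmat q x a p c r * (-1) ^ ((par p + par b) * par r)) •
      (rescaleHom x⁻¹ (tw1 (Lser T) p b) * tw1 (Lser T) r d)
    = ∑ p, ∑ r, (Rmat q x p b r d * (-1) ^ ((par a + par p) * par r)) •
      (tw1 (Lser T) c r * rescaleHom x⁻¹ (tw1 (Lser T) a p)) := by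
  ext n
  have h1 := congrFun (congrFun (rll_sum h x⁻¹ n) (a, c)) (b, d)
  have e1 : ∀ (k l : ℕ) (u : Fin (M + N) × Fin (M + N)),
      (tw2 (leg1 (Lcoef T k)) * tw2 (leg2 (Lcoef T l))) u (b, d)
      = ((-1 : ℂ) ^ ((par u.1 + par b) * par u.2)) •
        (tw1 (Lcoef T k) u.1 b * tw1 (Lcoef T l) u.2 d) := by
    intro k l u
    simp only [Matrix.mul_apply, tw2_leg1, tw2_leg2, Fintype.sum_prod_type, ite_mul, mul_ite,
      zero_mul, mul_zero, Finset.sum_ite_eq, Finset.sum_ite_eq', Finset.mem_univ, if_true,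
      Finset.sum_ite_irrel, Finset.sum_const_zero, neg_one_pow_mul_eq_smul, smul_mul_assoc]
  have e2 : ∀ (k l : ℕ) (u : Fin (M + N) × Fin (M + N)),
      (tw2 (leg2 (Lcoef T l)) * tw2 (leg1 (Lcoef T k))) (a, c) u
      = ((-1 : ℂ) ^ ((par a + par u.1) * par u.2)) •
        (tw1 (Lcoef T l) c u.2 * tw1 (Lcoef T k) a u.1) := by
    intro k l u
    simp only [Matrix.mul_apply, tw2_leg1, tw2_leg2, Fintype.sum_prod_type, ite_mul, mul_ite,
      zero_mul, mul_zero, Finset.sum_ite_eq, Finset.sum_ite_eq', Finset.mem_univ, if_true,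
      neg_one_pow_mul_eq_smul, mul_smul_comm, smul_ite, smul_zero]
  rw [Matrix.mul_apply, Matrix.mul_apply] at h1
  simp only [tw2_RcoefA, Matrix.sum_apply, Matrix.smul_apply, e1, e2, Fintype.sum_prod_type] at h1
  simp only [map_sum, coeff_complex_smul, PowerSeries.coeff_mul, coeff_rescaleHom, coeff_tw1_Lser]
  refine Eq.trans (Finset.sum_congr rfl fun p _ => Finset.sum_congr rfl fun r _ => ?_)
        (h1.trans (Finset.sum_congr rfl fun p _ => Finset.sum_congr rfl fun r _ => ?_))
  · rw [← Algebra.smul_def, mul_smul]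
    congr 1
    rw [Finset.smul_sum]
    refine Finset.sum_congr rfl fun kl _ => ?_
    rw [smul_mul_assoc, smul_comm]
  · rw [← Algebra.commutes, ← Algebra.smul_def, mul_smul]
    congr 1
    conv_rhs => rw [Finset.smul_sum]
    rw [← Finset.Nat.sum_antidiagonal_swap]
    refine Finset.sum_congr rfl fun kl _ => ?_
    simp only [Prod.fst_swap, Prod.snd_swap, mul_smul_comm]
    rw [smul_comm]

/-- The matrix of `X(x)` for a matrix `X` of power series, cf. `shift`. -/
def rescaleMat (t : ℂ) (X : Matrix (Fin (M + N)) (Fin (M + N)) (PowerSeries A)) :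
    Matrix (Fin (M + N)) (Fin (M + N)) (PowerSeries A) := X.map (rescaleHom t)

theorem rescaleMat_mul (t : ℂ) (X Y : Matrix (Fin (M + N)) (Fin (M + N)) (PowerSeries A)) :
    rescaleMat t (X * Y) = rescaleMat t X * rescaleMat t Y :=
  Matrix.map_mul

theorem rescaleMat_one (t : ℂ) :
    rescaleMat t (1 : Matrix (Fin (M + N)) (Fin (M + N)) (PowerSeries A)) = 1 :=
  Matrix.map_one _ (map_zero _) (map_one _)

theorem tw1_shift (s : ℂ) (X : Op1 M N (PowerSeries A)) :
    tw1 (shift s X) = rescaleMat s⁻¹ (tw1 X) := by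
  ext a b n
  simp only [rescaleMat, Matrix.map_apply, coeff_rescaleHom]
  unfold tw1 shift
  simp only [neg_one_pow_mul_eq_smul, coeff_complex_smul, PowerSeries.coeff_mk]
  rw [smul_comm]

theorem rll_blocks (h : ∀ i j, rllLeft q T i j = rllRight q T i j) (x : ℂ)
    (a b : Fin (M + N)) :
    ∑ p, scal (PowerSeries A) (fun i j => Rmat q x a p i j) *
      (blk (rescaleMat x⁻¹ (tw1 (Lser T))) p b * tw1 (Lser T))
    = ∑ p, tw1 (Lser T) * (blk (rescaleMat x⁻¹ (tw1 (Lser T))) a p *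
      scal (PowerSeries A) (fun i j => Rmat q x p b i j)) := by
  ext1 c d
  simp only [Matrix.sum_apply, Matrix.mul_apply, blk, scal, rescaleMat, Matrix.map_apply,
    Matrix.diagonal_apply, ite_mul, zero_mul, Finset.sum_ite_eq,
    Finset.mem_univ, if_true]
  refine Eq.trans ?_ ((rll_series h x a b c d).trans ?_)
  · refine Finset.sum_congr rfl fun p _ => Finset.sum_congr rfl fun r _ => ?_
    rw [← Algebra.smul_def, smul_mul_assoc, smul_smul]
  · refine Finset.sum_congr rfl fun p _ => Finset.sum_congr rfl fun r _ => ?_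
    rw [← Algebra.commutes, ← Algebra.smul_def, mul_smul_comm, mul_smul_comm, smul_smul]

/-- The relation R₂₁(x⁻¹) L₂(y) L₁(xy) = L₁(xy) L₂(y) R₂₁(x⁻¹). -/
theorem rll_flip_blocks (h : ∀ i j, rllLeft q T i j = rllRight q T i j) {x : ℂ} (hx : x ≠ 0)
    (a b : Fin (M + N)) :
    ∑ p, scal (PowerSeries A) (fun i j => Rflip q x a p i j) *
      (tw1 (Lser T) * blk (rescaleMat x⁻¹ (tw1 (Lser T))) p b)
    = ∑ p, blk (rescaleMat x⁻¹ (tw1 (Lser T))) a p *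
      (tw1 (Lser T) * scal (PowerSeries A) (fun i j => Rflip q x p b i j)) := by
  ext1 c d
  simp only [Matrix.sum_apply, Matrix.mul_apply, blk, scal, rescaleMat, Matrix.map_apply,
    Matrix.diagonal_apply, ite_mul, mul_ite, zero_mul, mul_zero, Finset.sum_ite_eq,
    Finset.sum_ite_eq', Finset.mem_univ, if_true, Rflip]
  -- Exchange the two factors in the relation at `x⁻¹`, then replace y by xy; the sign is that of
  -- the graded flip of V ⊗ V.
  have h1 := congrArg (fun z => ((-1 : ℂ) ^ (par a * par c + par b * par d)) • rescaleHom x⁻¹ z)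
    (rll_series h x⁻¹ c d a b)
  simp only [map_sum, map_smul, map_mul, rescaleHom_rescaleHom, inv_inv, inv_mul_cancel₀ hx,
    rescaleHom_one, Finset.smul_sum, smul_smul] at h1
  conv_lhs at h1 => rw [Finset.sum_comm]
  conv_rhs at h1 => rw [Finset.sum_comm]
  refine Eq.trans ?_ (h1.trans ?_)
  · refine Finset.sum_congr rfl fun p _ => Finset.sum_congr rfl fun r _ => ?_
    rw [← Algebra.smul_def, mul_smul_comm, smul_smul]
    congr 1
    have e := Rmat_sign q x⁻¹ c r a p
    have h2 := neg_one_pow_mul_self (par r * par p)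
    simp only [pow_add, add_mul]
    linear_combination (-(-1) ^ (par b * par d) * (-1) ^ (par r * par p) *
      (-1) ^ (par d * par p)) * e
      - (Rmat q x⁻¹ c r a p * (-1) ^ (par d * par p) * (-1) ^ (par b * par d)) * h2
  · simp only [Finset.mul_sum]
    refine Finset.sum_congr rfl fun p _ => Finset.sum_congr rfl fun r _ => ?_
    rw [← Algebra.commutes, ← Algebra.smul_def, mul_smul_comm, smul_mul_assoc, smul_smul]
    congr 1
    have e := Rmat_sign q x⁻¹ r d p b
    have h3 := neg_one_pow_mul_self (par b * par d)
    simp only [pow_add, add_mul]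
    linear_combination ((-1) ^ (par a * par c) * (-1) ^ (par c * par p) *
      (-1) ^ (par b * par d)) * e
      + ((-1) ^ (par a * par c) * (-1) ^ (par c * par p) * Rmat q x⁻¹ r d p b) * h3

end Relations

/-! ### Centrality of the coefficients of C(x). -/

section Centrality

variable {M N : ℕ} {A : Type} [Ring A] [Algebra ℂ A]
variable {q : ℂ} {T : Fin (M + N) → Fin (M + N) → ℕ → A}

/-- Multiplying `rll_flip_blocks` by L₁⁻¹(xy) on both sides. Arranging the blocks into matrices over
the matrix ring makes this a computation with an invertible element. -/
theorem rll_inv_blocks (h : ∀ i j, rllLeft q T i j = rllRight q T i j) {x : ℂ} (hx : x ≠ 0)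
    {U : Matrix (Fin (M + N)) (Fin (M + N)) (PowerSeries A)}
    (hLU : tw1 (Lser T) * U = 1) (hUL : U * tw1 (Lser T) = 1) (a b : Fin (M + N)) :
    ∑ p, blk (rescaleMat x⁻¹ U) a p *
      (scal (PowerSeries A) (fun i j => Rflip q x p b i j) * tw1 (Lser T))
    = ∑ p, tw1 (Lser T) *
      (scal (PowerSeries A) (fun i j => Rflip q x a p i j) * blk (rescaleMat x⁻¹ U) p b) := by
  let 𝓜 := Matrix (Fin (M + N)) (Fin (M + N)) (PowerSeries A)
  let R : Matrix (Fin (M + N)) (Fin (M + N)) 𝓜 :=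
    Matrix.of fun a b => scal (PowerSeries A) (fun i j => Rflip q x a b i j)
  let D : Matrix (Fin (M + N)) (Fin (M + N)) 𝓜 := Matrix.diagonal fun _ => tw1 (Lser T)
  let l : Matrix (Fin (M + N)) (Fin (M + N)) 𝓜 :=
    Matrix.of fun a b => blk (rescaleMat x⁻¹ (tw1 (Lser T))) a b
  let u : Matrix (Fin (M + N)) (Fin (M + N)) 𝓜 := Matrix.of fun a b => blk (rescaleMat x⁻¹ U) a b
  have hD : ∀ (X : Matrix (Fin (M + N)) (Fin (M + N)) 𝓜) i j, (D * X) i j = tw1 (Lser T) * X i j :=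
    fun _ _ _ => Matrix.diagonal_mul _ _ _ _
  have hD' : ∀ (X : Matrix (Fin (M + N)) (Fin (M + N)) 𝓜) i j, (X * D) i j = X i j * tw1 (Lser T) :=
    fun _ _ _ => Matrix.mul_diagonal _ _ _ _
  have hlu : l * u = 1 := by
    ext1 a b
    rw [Matrix.mul_apply]
    simp only [l, u, Matrix.of_apply]
    rw [sum_blk_mul_blk, ← rescaleMat_mul, hLU, rescaleMat_one, blk_one, Matrix.one_apply]
  have hul : u * l = 1 := by
    ext1 a b
    rw [Matrix.mul_apply]
    simp only [l, u, Matrix.of_apply]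
    rw [sum_blk_mul_blk, ← rescaleMat_mul, hUL, rescaleMat_one, blk_one, Matrix.one_apply]
  have hR : R * (D * l) = l * (D * R) := by
    ext1 a b
    rw [Matrix.mul_apply, Matrix.mul_apply]
    simp only [hD, R, l, Matrix.of_apply]
    exact rll_flip_blocks h hx a b
  have key : u * (R * D) = D * (R * u) := by
    calc u * (R * D) = u * (R * (D * (l * u))) := by rw [hlu, mul_one]
      _ = u * (R * (D * l)) * u := by simp only [mul_assoc]
      _ = (u * l) * (D * R * u) := by rw [hR]; simp only [mul_assoc]
      _ = _ := by rw [hul, one_mul, mul_assoc]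
  have h1 := congrFun (congrFun key a) b
  rw [Matrix.mul_apply, hD, Matrix.mul_apply] at h1
  simpa only [hD', R, u, Matrix.of_apply, Finset.mul_sum] using h1

theorem scal_mul_scal (r t : Fin (M + N) → Fin (M + N) → ℂ) :
    scal A r * scal A t = scal A fun i l => ∑ j, r i j * t j l := by
  ext i l
  simp only [scal, Matrix.mul_apply, map_sum, map_mul]

theorem sum_smul_scal {κ : Type} [Fintype κ] (c : κ → ℂ)
    (r : κ → Fin (M + N) → Fin (M + N) → ℂ) :
    ∑ a, c a • scal A (r a) = scal A fun i l => ∑ a, c a * r a i l := by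
  ext i l
  simp only [scal, Matrix.sum_apply, Matrix.smul_apply, map_sum, map_mul]
  simp only [Algebra.smul_def]

theorem scal_ite (c : ℂ) (p : Prop) [Decidable p] :
    scal A (fun i l : Fin (M + N) => if p ∧ i = l then c else 0) = if p then c • 1 else 0 := by
  ext i l
  by_cases hp : p
  · simp only [hp, true_and, if_true, scal, Matrix.smul_apply, Matrix.one_apply]
    split_ifs <;> simp [Algebra.smul_def]
  · simp [hp, scal]

/-- `block_commute` with l = L₁(xy), u = L₁⁻¹(xsy) and Λ = L₂(y): the block form of the assertion
that Z(xy) commutes with L(y). -/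
theorem rescale_commute (hq : q ≠ 0) (h : ∀ i j, rllLeft q T i j = rllRight q T i j)
    {U : Matrix (Fin (M + N)) (Fin (M + N)) (PowerSeries A)}
    (hLU : tw1 (Lser T) * U = 1) (hUL : U * tw1 (Lser T) = 1) {Z : PowerSeries A}
    (hZ : ∀ d e, ∑ a, (strWeight q a * (-1 : ℂ) ^ (par a * (par d + par e))) •
      (rescaleMat (q ^ (2 * ((M : ℤ) - N)))⁻¹ U a d * tw1 (Lser T) e a)
      = if d = e then strWeight q d • Z else 0)
    {x : ℂ} (hx : x ≠ 0) (hc : unitarity q x ≠ 0)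
    (hν : crossing x (q ^ (2 * ((M : ℤ) - N))) ≠ 0) (i j : Fin (M + N)) :
    rescaleHom x⁻¹ Z * tw1 (Lser T) i j = tw1 (Lser T) i j * rescaleHom x⁻¹ Z := by
  set s := q ^ (2 * ((M : ℤ) - N)) with hs
  have hs0 : s ≠ 0 := zpow_ne_zero _ hq
  have hcomm := block_commute (𝓜 := Matrix (Fin (M + N)) (Fin (M + N)) (PowerSeries A))
    par par_eq_zero_or_one
    (fun a b => scal (PowerSeries A) (fun i j => Rmat q x a b i j))
    (fun a b => scal (PowerSeries A) (fun i j => Rflip q x a b i j))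
    (fun a b => scal (PowerSeries A) (fun i j => Rflip q (x * s) a b i j))
    (fun a b => blk (rescaleMat (x * s)⁻¹ U) a b)
    (fun a b => blk (rescaleMat x⁻¹ (tw1 (Lser T))) a b)
    (tw1 (Lser T)) (Matrix.diagonal fun _ => rescaleHom x⁻¹ Z)
    (strWeight q) (unitarity q x) (crossing x s) (strWeight_ne_zero hq) hc hν
    (rll_blocks h x) (rll_inv_blocks h (mul_ne_zero hx hs0) hLU hUL)
    (fun a b => by
      simp only [scal_mul_scal]
      have := sum_smul_scal (A := PowerSeries A) (fun _ : Fin (M + N) => (1 : ℂ))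
        (fun p i l => ∑ j, Rflip q x a p i j * Rmat q x p b j l)
      simp only [one_smul, one_mul, sum_Rflip_mul_Rmat hq hx, scal_ite] at this
      exact this)
    (fun a b e g => blk_mul_scal _ _ a b e g fun c d => by
      simp only [Rflip]; exact (Rmat_even q _ c d e g).symm)
    (fun a b e g => blk_mul_scal _ _ a b e g fun c d => by
      simp only [Rflip]; exact (Rmat_even q _ c d e g).symm)
    (fun a b e g => blk_mul_scal _ _ a b e g fun c d => Rmat_even q x e g c d)
    (fun a b e g => blk_mul_scal _ _ a b e g fun c d => Rmat_even q x e g c d)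
    (fun p f => by
      simp only [scal_mul_scal, sum_smul_scal, Finset.mul_sum]
      simp only [hs, sum_Rflip_crossing hq hx, scal_ite])
    (fun p d => by
      simp only [scal_mul_scal, sum_smul_scal, Finset.mul_sum]
      simp only [hs, sum_crossing_Rflip hq hx hν, scal_ite])
    (fun d e => by
      have h1 := congrArg (rescaleHom x⁻¹) (hZ d e)
      simp only [map_sum, map_smul, map_mul, rescaleMat, Matrix.map_apply,
        rescaleHom_rescaleHom, apply_ite (rescaleHom x⁻¹), map_zero] at h1
      ext1 k l
      simp only [Matrix.sum_apply, blk, Matrix.diagonal_mul_diagonal, Matrix.smul_apply,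
        Matrix.diagonal_apply, rescaleMat, Matrix.map_apply, mul_inv]
      by_cases hkl : k = l
      · subst hkl
        simp only [if_true]
        have h2 := congrArg (fun z => ((-1 : ℂ) ^ ((par d + par e) * par k)) • z) h1
        simp only [Finset.smul_sum] at h2
        refine Eq.trans (Finset.sum_congr rfl fun a _ => ?_) (h2.trans ?_)
        · rw [smul_mul_smul_comm, smul_smul, smul_smul]
          congr 1
          have h3 := neg_one_pow_mul_self (par a * par k)
          simp only [add_mul, mul_add, pow_add]
          linear_combination (strWeight q a * (-1) ^ (par a * par d) * (-1) ^ (par a * par e) *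
            (-1) ^ (par d * par k) * (-1) ^ (par e * par k)) * h3
        · by_cases hde : d = e
          · subst hde
            rw [Even.neg_one_pow ⟨par d * par k, by ring⟩]
            simp
          · simp [hde]
      · by_cases hde : d = e <;> simp [hkl, hde]) i
  have := congrFun (congrFun hcomm i) j
  simpa only [Matrix.diagonal_mul, Matrix.mul_diagonal] using this

/-- In degree k + l the commutation identity is polynomial in `t`, and its coefficient of t^k is the
commutator of the coefficients `k` of `Z` and `l` of `f`. -/
theorem commute_coeff_of_rescale {Z f : PowerSeries A}
    (h : {t : ℂ | rescaleHom t Z * f = f * rescaleHom t Z}.Infinite) (k l : ℕ) :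
    Commute (PowerSeries.coeff k Z) (PowerSeries.coeff l f) := by
  have := eq_zero_of_infinite_zeros (k + l + 1) (fun i =>
    PowerSeries.coeff i Z * PowerSeries.coeff (k + l - i) f
      - PowerSeries.coeff (k + l - i) f * PowerSeries.coeff i Z) ?_ (k := k) (by omega)
  · rw [Nat.add_sub_cancel_left] at this
    exact sub_eq_zero.mp this
  · refine h.mono fun t ht => ?_
    have h1 := congrArg (PowerSeries.coeff (k + l)) (show _ = _ from ht)
    rw [PowerSeries.coeff_mul, PowerSeries.coeff_mul, ← Finset.Nat.sum_antidiagonal_swap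
      (f := fun p => PowerSeries.coeff p.1 f * _),
      Finset.Nat.sum_antidiagonal_eq_sum_range_succ_mk,
      Finset.Nat.sum_antidiagonal_eq_sum_range_succ_mk] at h1
    simp only [Prod.fst_swap, Prod.snd_swap, coeff_rescaleHom, smul_mul_assoc,
      mul_smul_comm] at h1
    change ∑ i ∈ Finset.range (k + l + 1), _ = _
    simp only [smul_sub, Finset.sum_sub_distrib]
    exact sub_eq_zero_of_eq h1

theorem infinite_generic (hq : q ≠ 0) (s : ℂ) :
    {t : ℂ | t ≠ 0 ∧ unitarity q t⁻¹ ≠ 0 ∧ crossing t⁻¹ s ≠ 0}.Infinite := by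
  -- With t = x⁻¹, the factor `unitarity` vanishes at t = q² and t = q⁻², and `crossing` at t = s
  -- and t = 1.
  have hf : ({0, q * q, (q * q)⁻¹, s, 1} : Set ℂ).Finite := by simp
  refine hf.infinite_compl.mono fun t ht => ?_
  simp only [Set.mem_compl_iff, Set.mem_insert_iff, Set.mem_singleton_iff, not_or] at ht
  obtain ⟨h0, h1, h2, h3, h4⟩ := ht
  refine ⟨h0, mul_ne_zero ?_ ?_, mul_ne_zero ?_ ?_⟩
  · intro h
    apply h1
    rw [inv_inv] at h
    field_simp at h
    linear_combination -h
  · intro h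
    apply h2
    field_simp at h ⊢
    linear_combination h
  · intro h
    apply h3
    field_simp at h
    linear_combination h
  · intro h
    apply h4
    rw [inv_inv] at h
    linear_combination -h

theorem casimir_eq (L Linv : Op1 M N (PowerSeries A)) :
    casimir q L Linv = ∑ a, strWeight q a •
      (rescaleMat (q ^ (2 * ((M : ℤ) - N)))⁻¹ (tw1 Linv) * tw1 L) a a := by
  have e : ∀ (X : Op1 M N (PowerSeries A)) (a : Fin (M + N)), tw1 X a a = X a a := by
    intro X a
    rw [tw1, Even.neg_one_pow ⟨par a * par a, by ring⟩, one_mul]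
  simp only [← tw1_shift, ← tw1_mul1, e]
  rfl

/-- The one place where `q` not being a root of unity enters. -/
theorem zpow_two_mul_sub_ne_one (hq : ∀ n : ℕ, 0 < n → q ^ n ≠ 1) (hMN : M ≠ N) :
    q ^ (2 * ((M : ℤ) - N)) ≠ 1 := by
  intro h
  rcases lt_or_gt_of_ne hMN with hlt | hlt
  · apply hq (2 * (N - M)) (by omega)
    have e : (2 * ((M : ℤ) - N)) = -((2 * (N - M) : ℕ) : ℤ) := by omega
    rwa [e, zpow_neg, inv_eq_one, zpow_natCast] at h
  · apply hq (2 * (M - N)) (by omega)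
    have e : (2 * ((M : ℤ) - N)) = ((2 * (M - N) : ℕ) : ℤ) := by omega
    rwa [e, zpow_natCast] at h

/-- The coefficients of `C(x)` commute with the generators. -/
theorem commute_casimir (hq0 : q ≠ 0) (hq : ∀ n : ℕ, 0 < n → q ^ n ≠ 1)
    (h : ∀ i j, rllLeft q T i j = rllRight q T i j) {Linv : Op1 M N (PowerSeries A)}
    (hL : IsInv1 (Lser T) Linv) (n : ℕ) (a b : Fin (M + N)) (k : ℕ) :
    Commute (PowerSeries.coeff n (casimir q (Lser T) Linv)) (T a b k) := by
  obtain ⟨hLU, hUL⟩ := (isInv1_iff _ _).mp hL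
  rw [casimir_eq]
  -- For M = N there is no shift, the degeneration argument is unavailable, and L⁻¹L = 1 makes the
  -- series a constant scalar.
  by_cases hMN : M = N
  · subst hMN
    have e : rescaleMat (q ^ (2 * ((M : ℤ) - M)))⁻¹ (tw1 Linv) = tw1 Linv := by
      ext i j
      simp [rescaleMat, rescaleHom_one]
    rw [e, hUL]
    simp only [Matrix.one_apply_eq, map_sum, coeff_complex_smul, PowerSeries.coeff_one]
    refine Commute.sum_left _ _ _ fun c _ => Commute.smul_left ?_ _
    split_ifs
    · exact Commute.one_left _
    · exact Commute.zero_left _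
  · have hs1 := zpow_two_mul_sub_ne_one hq hMN
    have hs0 : q ^ (2 * ((M : ℤ) - N)) ≠ 0 := zpow_ne_zero _ hq0
    obtain ⟨Z, hZ⟩ := exists_transpose_inverse hq0 hs1 _ _ (rll_inv_blocks h hs0 hLU hUL)
    -- The diagonal part of `hZ` sums to the quantum supertrace, so C is the scalar ∑ θ_d times `Z`.
    have hC : ∑ a, strWeight q a •
        (rescaleMat (q ^ (2 * ((M : ℤ) - N)))⁻¹ (tw1 Linv) * tw1 (Lser T)) a a
        = ∑ d : Fin (M + N), strWeight q d • Z := by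
      simp only [Matrix.mul_apply, Finset.smul_sum]
      rw [Finset.sum_comm]
      refine Finset.sum_congr rfl fun d _ => ?_
      have h1 := hZ d d
      rw [if_pos rfl] at h1
      rw [← h1]
      refine Finset.sum_congr rfl fun a _ => ?_
      rw [Even.neg_one_pow ⟨par a * par d, by ring⟩, mul_one]
    rw [hC]
    simp only [map_sum, coeff_complex_smul]
    refine Commute.sum_left _ _ _ fun c _ => Commute.smul_left ?_ _
    have h1 : Commute (PowerSeries.coeff n Z) (PowerSeries.coeff k (tw1 (Lser T) b a)) := by
      refine commute_coeff_of_rescale ((infinite_generic hq0 (q ^ (2 * ((M : ℤ) - N)))).mono fun t ht => ?_) n k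
      have := rescale_commute hq0 h hLU hUL hZ (inv_ne_zero ht.1) ht.2.1 ht.2.2 b a
      rwa [inv_inv] at this
    rw [coeff_tw1_Lser] at h1
    unfold tw1 Lcoef at h1
    rw [neg_one_pow_mul_eq_smul, neg_one_pow_mul_eq_smul, smul_smul] at h1
    have h2 := h1.smul_right (((-1 : ℂ) ^ ((par b + par a) * par a) * (-1) ^ par a))⁻¹
    rwa [smul_smul, inv_mul_cancel₀, one_smul] at h2
    exact mul_ne_zero (pow_ne_zero _ (by norm_num)) (pow_ne_zero _ (by norm_num))

end Centrality

/-! ### Existence and uniqueness of L⁻¹(x). -/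

section Inverse

variable {M N : ℕ} {A : Type} [Ring A]

/-- `L(x)` is invertible if `L[0]` is. -/
theorem existsUnique_inverse (T : Fin (M + N) → Fin (M + N) → ℕ → A) {K : Op1 M N A}
    (hK : IsInv1 (Lcoef T 0) K) : ∃! Linv, IsInv1 (Lser T) Linv := by
  -- Series of matrices are identified with matrices of series, since a series over a noncommutative
  -- ring with unit constant term is invertible.
  let toMat : PowerSeries (Matrix (Fin (M + N)) (Fin (M + N)) A) →
      Matrix (Fin (M + N)) (Fin (M + N)) (PowerSeries A) :=
    fun f i j => PowerSeries.mk fun k => PowerSeries.coeff k f i j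
  have hmul : ∀ f g, toMat (f * g) = toMat f * toMat g := by
    intro f g
    ext i j n
    rw [Matrix.mul_apply, map_sum]
    simp only [toMat, PowerSeries.coeff_mk, PowerSeries.coeff_mul]
    rw [Matrix.sum_apply, Finset.sum_comm]
    exact Finset.sum_congr rfl fun _ _ => Matrix.mul_apply
  have hone : toMat 1 = 1 := by
    ext i j n
    simp only [toMat, PowerSeries.coeff_mk, PowerSeries.coeff_one, Matrix.one_apply]
    by_cases hij : i = j
    · subst hij
      rw [if_pos rfl, PowerSeries.coeff_one]
      split_ifs
      · exact Matrix.one_apply_eq i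
      · rfl
    · rw [if_neg hij, map_zero]
      split_ifs
      · exact Matrix.one_apply_ne hij
      · rfl
  let f : PowerSeries (Matrix (Fin (M + N)) (Fin (M + N)) A) := PowerSeries.mk fun k => tw1 (Lcoef T k)
  have hf : toMat f = tw1 (Lser T) := by
    ext i j n
    simp only [toMat, f, PowerSeries.coeff_mk, coeff_tw1_Lser]
  obtain ⟨h1, h2⟩ := (isInv1_iff _ _).mp hK
  let v : (Matrix (Fin (M + N)) (Fin (M + N)) A)ˣ := ⟨tw1 (Lcoef T 0), tw1 K, h1, h2⟩
  have hv : PowerSeries.constantCoeff f = v := by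
    rw [← PowerSeries.coeff_zero_eq_constantCoeff_apply, PowerSeries.coeff_mk]
  obtain ⟨Y, hY⟩ := exists_tw1_eq (toMat (PowerSeries.invOfUnit f v))
  have hYinv : IsInv1 (Lser T) Y := by
    rw [isInv1_iff, hY, ← hf, ← hmul, ← hmul, PowerSeries.mul_invOfUnit f v hv,
      PowerSeries.invOfUnit_mul f v hv, hone]
    exact ⟨rfl, rfl⟩
  refine ⟨Y, hYinv, fun Y' hY' => tw1_injective ?_⟩
  rw [isInv1_iff] at hYinv hY'
  exact left_inv_eq_right_inv hY'.2 hYinv.1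

end Inverse

/-! ### Transport along algebra maps, and centrality tested on generators. -/

section Maps

variable {M N : ℕ} {A B : Type} [Ring A] [Algebra ℂ A] [Ring B] [Algebra ℂ B] (f : A →ₐ[ℂ] B)

theorem map_mul1 (X Y : Op1 M N A) (a b : Fin (M + N)) :
    f (mul1 X Y a b) = mul1 (fun a b => f (X a b)) (fun a b => f (Y a b)) a b := by
  simp [mul1]

theorem map_mul2 (X Y : Op2 M N A) (a b c d : Fin (M + N)) :
    f (mul2 X Y a b c d)
      = mul2 (fun a b c d => f (X a b c d)) (fun a b c d => f (Y a b c d)) a b c d := by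
  simp [mul2]

theorem map_leg1 (X : Op1 M N A) (a b c d : Fin (M + N)) :
    f (leg1 X a b c d) = leg1 (fun a b => f (X a b)) a b c d := by
  simp only [leg1, apply_ite f, map_zero]

theorem map_leg2 (X : Op1 M N A) (a b c d : Fin (M + N)) :
    f (leg2 X a b c d) = leg2 (fun a b => f (X a b)) a b c d := by
  simp only [leg2, apply_ite f, map_zero]

theorem map_RcoefA (q : ℂ) (m : ℕ) (a b c d : Fin (M + N)) :
    f (RcoefA q m a b c d) = RcoefA q m a b c d := f.commutes _

theorem map_Lcoef (T : Fin (M + N) → Fin (M + N) → ℕ → A) (k : ℕ) (a b : Fin (M + N)) :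
    f (Lcoef T k a b) = Lcoef (fun a b k => f (T a b k)) k a b := by
  simp [Lcoef]

theorem map_rllLeft (q : ℂ) (T : Fin (M + N) → Fin (M + N) → ℕ → A) (i j : ℕ)
    (a b c d : Fin (M + N)) :
    f (rllLeft q T i j a b c d) = rllLeft q (fun a b k => f (T a b k)) i j a b c d := by
  simp only [rllLeft, Finset.sum_apply, map_sum]
  refine Finset.sum_congr rfl fun m _ => Finset.sum_congr rfl fun kl _ => ?_
  split_ifs
  · simp only [map_mul2, map_leg1, map_leg2, map_RcoefA, map_Lcoef]
  · exact map_zero f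

theorem map_rllRight (q : ℂ) (T : Fin (M + N) → Fin (M + N) → ℕ → A) (i j : ℕ)
    (a b c d : Fin (M + N)) :
    f (rllRight q T i j a b c d) = rllRight q (fun a b k => f (T a b k)) i j a b c d := by
  simp only [rllRight, Finset.sum_apply, map_sum]
  refine Finset.sum_congr rfl fun m _ => Finset.sum_congr rfl fun kl _ => ?_
  split_ifs
  · simp only [map_mul2, map_leg1, map_leg2, map_RcoefA, map_Lcoef]
  · exact map_zero f

theorem mem_center_of_commute_generators {X : Type} (g : FreeAlgebra ℂ X →ₐ[ℂ] A)
    (hg : Function.Surjective g) {z : A} (h : ∀ x, Commute z (g (FreeAlgebra.ι ℂ x))) :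
    z ∈ Subalgebra.center ℂ A := by
  rw [Subalgebra.mem_center_iff]
  intro b
  obtain ⟨y, rfl⟩ := hg b
  suffices Commute z (g y) from this.symm
  induction y using FreeAlgebra.induction with
  | grade0 r => rw [AlgHom.commutes]; exact (Algebra.commutes r z).symm
  | grade1 x => exact h x
  | mul a b ha hb => rw [map_mul]; exact ha.mul_right hb
  | add a b ha hb => rw [map_add]; exact ha.add_right hb

/-- Needed for the generators of version (ii) that are entries of the inverse of L[0]: what commutes
with an invertible matrix commutes with its inverse. -/
theorem commute_inverse_entries {X Y : Op1 M N A} (hXY : IsInv1 X Y) {z : A}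
    (h : ∀ a b, Commute z (X a b)) (a b : Fin (M + N)) : Commute z (Y a b) := by
  obtain ⟨h1, h2⟩ := (isInv1_iff _ _).mp hXY
  let D : Matrix (Fin (M + N)) (Fin (M + N)) A := Matrix.diagonal fun _ => z
  have hD : D * tw1 X = tw1 X * D := by
    ext i j
    simp only [D, Matrix.diagonal_mul, Matrix.mul_diagonal, tw1, neg_one_pow_mul_eq_smul]
    exact ((h i j).smul_right _).eq
  have hD' : D * tw1 Y = tw1 Y * D := by
    calc D * tw1 Y = tw1 Y * tw1 X * (D * tw1 Y) := by rw [h2, one_mul]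
      _ = tw1 Y * (D * tw1 X) * tw1 Y := by rw [hD]; simp only [mul_assoc]
      _ = tw1 Y * D * (tw1 X * tw1 Y) := by simp only [mul_assoc]
      _ = _ := by rw [h1, mul_one]
  have h3 : Commute z (tw1 Y a b) := by
    have := congrFun (congrFun hD' a) b
    simp only [D, Matrix.diagonal_mul, Matrix.mul_diagonal] at this
    exact this
  rw [tw1, neg_one_pow_mul_eq_smul] at h3
  have h4 := h3.smul_right ((-1 : ℂ) ^ ((par a + par b) * par b))
  rwa [smul_smul, neg_one_pow_mul_self, one_smul] at h4

end Maps

/-! ### The two presentations of the algebra. -/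

section Presentations

variable (M N : ℕ) (q : ℂ)

theorem unitalT_rll (i j : ℕ) :
    rllLeft q (unitalT M N q) i j = rllRight q (unitalT M N q) i j := by
  funext a b c d
  have h := RingQuot.mkAlgHom_rel ℂ (UnitalRel.rll (M := M) (N := N) (q := q) i j a b c d)
  rw [map_rllLeft, map_rllRight] at h
  exact h

theorem yangianT_rll (i j : ℕ) :
    rllLeft q (yangianT M N q) i j = rllRight q (yangianT M N q) i j := by
  funext a b c d
  have h := RingQuot.mkAlgHom_rel ℂ (YangianRel.rll (M := M) (N := N) (q := q) i j a b c d)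
  rw [map_rllLeft, map_rllRight] at h
  exact h

theorem Lcoef_freeT_zero : Lcoef (freeT M N) 0 = one1 := by
  funext a b
  unfold Lcoef freeT one1
  rw [dif_neg (lt_irrefl 0)]
  by_cases h : b = a
  · subst h
    rw [if_pos rfl, if_pos rfl, ← pow_add, Even.neg_one_pow ⟨par b, rfl⟩]
  · simp [h, Ne.symm h]

theorem Lcoef_unitalT_zero : Lcoef (unitalT M N q) 0 = one1 := by
  funext a b
  refine (map_Lcoef (RingQuot.mkAlgHom ℂ (UnitalRel M N q)) (freeT M N) 0 a b).symm.trans ?_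
  rw [Lcoef_freeT_zero]
  simp only [one1, apply_ite (RingQuot.mkAlgHom ℂ (UnitalRel M N q)), map_zero, map_one]

theorem isInv1_Lcoef_unitalT_zero : IsInv1 (Lcoef (unitalT M N q) 0) one1 := by
  rw [Lcoef_unitalT_zero, isInv1_iff, tw1_one1, one_mul]
  exact ⟨rfl, rfl⟩

/-- The inverse of `L[0]` in the quantum super Yangian with free constant term. -/
def yangianInv : Op1 M N (Yangian M N q) := fun a b =>
  RingQuot.mkAlgHom ℂ (YangianRel M N q) (genInv M N a b)

theorem isInv1_Lcoef_yangianT_zero : IsInv1 (Lcoef (yangianT M N q) 0) (yangianInv M N q) := by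
  have e : ∀ a b : Fin (M + N), RingQuot.mkAlgHom ℂ (YangianRel M N q) (one1 a b) = one1 a b := by
    intro a b
    simp only [one1, apply_ite (RingQuot.mkAlgHom ℂ (YangianRel M N q)), map_zero, map_one]
  constructor
  · funext a b
    have h := RingQuot.mkAlgHom_rel ℂ (YangianRel.mul_inv (M := M) (N := N) (q := q) a b)
    rw [map_mul1, e] at h
    simp only [map_Lcoef] at h
    exact h
  · funext a b
    have h := RingQuot.mkAlgHom_rel ℂ (YangianRel.inv_mul (M := M) (N := N) (q := q) a b)
    rw [map_mul1, e] at h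
    simp only [map_Lcoef] at h
    exact h

theorem mem_center_unitalYangian {z : UnitalYangian M N q}
    (h : ∀ a b k, Commute z (unitalT M N q a b k)) :
    z ∈ Subalgebra.center ℂ (UnitalYangian M N q) := by
  refine mem_center_of_commute_generators _ (RingQuot.mkAlgHom_surjective ℂ (UnitalRel M N q)) ?_
  rintro ⟨a, b, k, hk⟩
  have := h a b k
  rwa [unitalT, freeT, dif_pos hk] at this

theorem mem_center_yangian {z : Yangian M N q} (h : ∀ a b k, Commute z (yangianT M N q a b k)) :
    z ∈ Subalgebra.center ℂ (Yangian M N q) := by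
  refine mem_center_of_commute_generators _ (RingQuot.mkAlgHom_surjective ℂ (YangianRel M N q)) ?_
  rintro (⟨a, b, k⟩ | ⟨a, b⟩)
  · exact h a b k
  · refine commute_inverse_entries (isInv1_Lcoef_yangianT_zero M N q) (fun a b => ?_) a b
    rw [Lcoef, neg_one_pow_mul_eq_smul]
    exact (h b a 0).smul_right _

end Presentations

end SuperYangian

end

theorem lemma1 (M N : ℕ) (q : ℂ) (hq0 : q ≠ 0) (hq : ∀ n : ℕ, 0 < n → q ^ n ≠ 1) :
    ((∃! Linv, IsInv1 (Lser (unitalT M N q)) Linv) ∧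
      ∀ Linv, IsInv1 (Lser (unitalT M N q)) Linv →
        ∀ n : ℕ,
          PowerSeries.coeff n
              (casimir q (Lser (unitalT M N q)) Linv)
            ∈ Subalgebra.center ℂ (UnitalYangian M N q) ∧
          ∀ (a b : Fin (M + N)) (k : ℕ),
            ⁅PowerSeries.coeff n
                (casimir q (Lser (unitalT M N q)) Linv),
              unitalT M N q a b k⁆ = 0) ∧
    ((∃! Linv, IsInv1 (Lser (yangianT M N q)) Linv) ∧
      ∀ Linv, IsInv1 (Lser (yangianT M N q)) Linv →
        ∀ n : ℕ,
          PowerSeries.coeff n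
              (casimir q (Lser (yangianT M N q)) Linv)
            ∈ Subalgebra.center ℂ (Yangian M N q) ∧
          ∀ (a b : Fin (M + N)) (k : ℕ),
            ⁅PowerSeries.coeff n
                (casimir q (Lser (yangianT M N q)) Linv),
              yangianT M N q a b k⁆ = 0) := by

  refine ⟨⟨existsUnique_inverse _ (isInv1_Lcoef_unitalT_zero M N q), fun Linv hL n => ?_⟩,
    ⟨existsUnique_inverse _ (isInv1_Lcoef_yangianT_zero M N q), fun Linv hL n => ?_⟩⟩
  · have h := commute_casimir hq0 hq (unitalT_rll M N q) hL n
    exact ⟨mem_center_unitalYangian M N q h, fun a b k => (h a b k).lie_eq⟩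
  · have h := commute_casimir hq0 hq (yangianT_rll M N q) hL n
    exact ⟨mem_center_yangian M N q h, fun a b k => (h a b k).lie_eq⟩
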